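/- Let $d$ be a dimension, write points of $\mathbf{R}^{d+1}=\mathbf{R}\times\mathbf{R}^{d}$ as $(t,x)$, and let $l$ be a function on $(0,\infty)$, $C_0>1$, $M_0,M_1\ge 0$ and $2<p<\infty$. There is a finite constant $A_p$, depending only on $d,l,C_0,M_0,M_1,p$, with the following property. Let $\kappa:(0,\infty)\to(0,\infty)$ be continuous with $\lim_{\delta\to0}\kappa(\delta)=0$ and $\lim_{\delta\to\infty}\kappa(\delta)=\infty$, and suppose that $l$ is a scaling factor of $\kappa$: $l$ is nondecreasing and continuous, $\lim_{\varepsilon\to0}l(\varepsilon)=0$, and $\kappa(\varepsilon r)\le l(\varepsilon)\kappa(r)$ for all $\varepsilon,r>0$. For $(t,x)\in\mathbf{R}^{d+1}$ and $\delta>0$ put $Q_\delta(t,x)=(t-\kappa(\delta),t+\kappa(\delta))\times B_\delta(x)$, where $B_\delta(x)$ is the open Euclidean ball. Let $V$ be a separable real Hilbert space and let $K:\mathbf{R}^{d+1}\times\mathbf{R}^{d+1}\to\mathbf{R}$ be measurable and such that for almost all $(t,x)$ the function $K(t,x,\cdot)f$ is integrable on $\mathbf{R}^{d+1}$ for every $f\in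 C_0^\infty(\mathbf{R}^{d+1};V)$. Write $$\mathcal{K}f(t,x,s)=\int_{\mathbf{R}^d}K(t,x,s,y)f(s,y)\,dy,\qquad \mathcal{G}f(t,x)=\Big[\int_{\mathbf{R}}|\mathcal{K}f(t,x,s)|_V^2\,ds\Big]^{1/2}.$$ Assume that (i) $|\mathcal{G}f|_{L_2(\mathbf{R}^{d+1})}\le M_0|f|_{L_2(\mathbf{R}^{d+1};V)}$ for all $f\in C_0^\infty(\mathbf{R}^{d+1};V)$; (ii) (Hörmander condition) for all $(t,x)\in\mathbf{R}^{d+1}$, $\delta>0$ and $(\bar t,\bar x)\in Q_\delta(t,x)$, $$\int\Big[\int\chi_{Q_{C_0\delta}(t,x)^c}(r,y)\,|K(t,x,r,y)-K(\bar t,\bar x,r,y)|\,dy\Big]^2dr\le M_1 .$$ Then for every $f\in L_2(\mathbf{R}^{d+1};V)\cap L_p(\mathbf{R}^{d+1};V)$, $$|\mathcal{G}f|_{L_p(\mathbf{R}^{d+1})}\le A_p|f|_{L_p(\mathbf{R}^{d+1};V)} .$$ This holds both for $\mathcal{G}f$ defined by the formula above (the inner integral being read as $0$ at those $(t,x,s)$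 where it does not converge absolutely) and for the $L_2$-extension. That is, $\mathcal{K}$ extends from $C_0^\infty(\mathbf{R}^{d+1};V)$ to $L_2(\mathbf{R}^{d+1};V)$ by continuity into $L_2(\mathbf{R}^{d+1}\times\mathbf{R};V)$: there is an $F\in L_2(\mathbf{R}^{d+1}\times\mathbf{R};V)$ that is the $L_2$-limit of $\mathcal{K}\varphi_n$ for some $\varphi_n\in C_0^\infty(\mathbf{R}^{d+1};V)$ with $\varphi_n\to f$ in $L_2$. Every such $F$ satisfies $F(t,x,s)=\int K(t,x,s,y)f(s,y)\,dy$ for almost every $(t,x)$ and almost every $s$ for which this integral converges absolutely, and $$\Big|\Big[\int|F(\cdot,\cdot,s)|_V^2\,ds\Big]^{1/2}\Big|_{L_p(\mathbf{R}^{d+1})}\le A_p|f|_{L_p(\mathbf{R}^{d+1};V)} .$$ -/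

import Mathlib

open MeasureTheory Filter Topology Set
open scoped ENNReal NNReal ContDiff

namespace StochHormander

/-- Space-time `ℝ^{d+1} = ℝ × ℝ^d`, with points `z = (t, x)` and Lebesgue measure `volume`. -/
abbrev SpaceTime (d : ℕ) : Type := ℝ × EuclideanSpace ℝ (Fin d)

/-- `κ : (0,∞) → (0,∞)` is continuous with `κ(0+) = 0` and `κ(∞) = ∞`
(the values of `κ` outside `(0,∞)` are irrelevant). -/
structure IsScalingFunction (κ : ℝ → ℝ) : Prop where
  pos : ∀ r, 0 < r → 0 < κ r
  continuousOn : ContinuousOn κ (Ioi 0)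
  tendsto_zero : Tendsto κ (𝓝[>] 0) (𝓝 0)
  tendsto_atTop : Tendsto κ atTop atTop

/-- `l` is a scaling factor of `κ`: nondecreasing and continuous on `(0,∞)`, `l(0+) = 0`, and
`κ(ε r) ≤ l(ε) κ(r)` for all `ε, r > 0`. -/
structure IsScalingFactor (κ l : ℝ → ℝ) : Prop where
  monotoneOn : MonotoneOn l (Ioi 0)
  continuousOn : ContinuousOn l (Ioi 0)
  tendsto_zero : Tendsto l (𝓝[>] 0) (𝓝 0)
  scaling : ∀ ε r, 0 < ε → 0 < r → κ (ε * r) ≤ l ε * κ r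

/-- The parabolic cylinder `Q_δ(t,x) = (t - κ(δ), t + κ(δ)) × B_δ(x)`. -/
def cylinder {d : ℕ} (κ : ℝ → ℝ) (δ : ℝ) (z : SpaceTime d) : Set (SpaceTime d) :=
  Ioo (z.1 - κ δ) (z.1 + κ δ) ×ˢ Metric.ball z.2 δ

section

variable {d : ℕ} {V : Type*} [NormedAddCommGroup V] [InnerProductSpace ℝ V]

/-- `f ∈ C_0^∞(ℝ^{d+1}; V)`. -/
def IsTestFunction (f : SpaceTime d → V) : Prop :=
  ContDiff ℝ ∞ f ∧ HasCompactSupport f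

/-- `𝒦f(t,x,s) = ∫ K(t,x,s,y) f(s,y) dy`. -/
noncomputable def kernelTransform (K : SpaceTime d → SpaceTime d → ℝ) (f : SpaceTime d → V)
    (z : SpaceTime d) (s : ℝ) : V :=
  ∫ y, K z (s, y) • f (s, y)

/-- `(t,x) ↦ [∫ |F(t,x,s)|_V² ds]^{1/2}`, with values in `[0,∞]`. -/
noncomputable def squareFunction (F : SpaceTime d → ℝ → V) (z : SpaceTime d) : ℝ≥0∞ :=
  (∫⁻ s, ‖F z s‖ₑ ^ 2) ^ (1 / 2 : ℝ)

/-- `𝒢f(t,x) = [∫ |∫ K(t,x,s,y) f(s,y) dy|_V² ds]^{1/2}`. -/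
noncomputable def stochOperator (K : SpaceTime d → SpaceTime d → ℝ) (f : SpaceTime d → V) :
    SpaceTime d → ℝ≥0∞ :=
  squareFunction (kernelTransform K f)

/-- `F` is the image of `f` under the `L²`-continuous extension of `𝒦` from test functions:
for some test functions `φ n → f` in `L²(ℝ^{d+1}; V)`, `𝒦(φ n) → F` in
`L²(ℝ^{d+1} × ℝ; V)`. The inner integral defining `𝒦f` need not converge for general `f ∈ L²`. -/
def IsL2Transform (K : SpaceTime d → SpaceTime d → ℝ) (f : SpaceTime d → V)
    (F : SpaceTime d → ℝ → V) : Prop :=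
  AEStronglyMeasurable (Function.uncurry F) volume ∧
  ∃ φ : ℕ → SpaceTime d → V, (∀ n, IsTestFunction (φ n)) ∧
    Tendsto (fun n => eLpNorm (φ n - f) 2 volume) atTop (𝓝 0) ∧
    Tendsto (fun n => eLpNorm (squareFunction (kernelTransform K (φ n) - F)) 2 volume)
      atTop (𝓝 0)

end

/-- The stochastic Hörmander condition: for every cylinder `Q_δ(t,x)` and every
`(t',x') ∈ Q_δ(t,x)`,
`∫ [∫ 1_{Q_{C₀δ}(t,x)ᶜ}(r,y) |K(t,x,r,y) - K(t',x',r,y)| dy]² dr ≤ M₁`. -/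
def HormanderCondition {d : ℕ} (κ : ℝ → ℝ) (C₀ : ℝ) (M₁ : ℝ≥0)
    (K : SpaceTime d → SpaceTime d → ℝ) : Prop :=
  ∀ (z : SpaceTime d) (δ : ℝ), 0 < δ → ∀ z' ∈ cylinder κ δ z,
    ∫⁻ r, (∫⁻ y, (cylinder κ (C₀ * δ) z)ᶜ.indicator (fun w => ‖K z w - K z' w‖ₑ) (r, y)) ^ 2
      ≤ M₁

end StochHormander

/-! Write `G` for `𝒢f` squared, i.e. `squareIntegral (kernelTransform K f)`. The `L^p` bound for
`𝒢f` is an `L^(1+s)` bound for `G` in terms of `U = |f|²`, with `s = p/2 - 1 > 0`. It comes from a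
good-λ type argument that stops on `G` itself, not on `f`.

Fix a level `τ` and take the maximal dyadic cells on which the average of `G` exceeds `τ`. By
doubling, these averages are also at most `N τ`. Cut `f` at height `r`, where `r² = η τ`. On a
stopping cell `Q` the function `f` has three pieces: its large values, its small values on an
enlarged cylinder, and its small values away from that cylinder. The `L²` bound controls the first
two. By the Hörmander condition the transform of the third varies over `Q` by at most a multiple of
`r² ≤ τ` (in squared `L²(ds)` norm). So `G` at one point of `Q` is compared with its average over
`Q`, which is `O(τ)`. This is `setLIntegral_squareIntegral_tsub_le`.

Summing over the cells (`DyadicSystem.lintegral_tsub_le`) bounds `∫ (G - C τ)₊` by a multiple of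
`∫_{U > ητ} U` plus `O(η) ∫_{2G > τ} G`. Integration against `τ^(s-1) dτ` turns all three terms into
`(1+s)`-th powers, and for small `η` the last one is absorbed (`exists_lintegral_rpow_le`). The
constants depend on `κ` only through `l`, because the cells of `exists_dyadicSystem` do.

All this is done for bounded `f` of bounded support, where every integral makes sense. General `f`
is reached by truncation: the truncated transforms converge in `L²` to the extension, almost
everywhere along a subsequence, and Fatou's lemma transfers the bound. -/

namespace StochHormander

/-! ### Dyadic partitions, stopping cells and differentiation. -/

/-- A doubling dyadic system: a nested sequence of countable partitions, coarser as `n → -∞`. -/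
structure DyadicSystem {X : Type*} [MeasurableSpace X] [TopologicalSpace X] (μ : Measure X)
    (ι : Type*) (N : ℝ≥0) where
  idx : ℤ → X → ι
  measurableSet_fiber : ∀ n i, MeasurableSet (idx n ⁻¹' {i})
  nested : ∀ n z w, idx (n + 1) z = idx (n + 1) w → idx n z = idx n w
  measure_ne_top : ∀ n z, μ (idx n ⁻¹' {idx n z}) ≠ ⊤
  doubling : ∀ n z, μ (idx n ⁻¹' {idx n z}) ≤ N * μ (idx (n + 1) ⁻¹' {idx (n + 1) z})
  -- This makes every stopping rule used below fail on all sufficiently coarse cells, so that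
  -- maximal cells exist.
  large : ∀ z (M : ℝ≥0), ∃ n₀, ∀ n ≤ n₀, M < μ (idx n ⁻¹' {idx n z})
  shrinking : ∀ z, ∀ U ∈ 𝓝 z, ∃ n, idx n ⁻¹' {idx n z} ⊆ U

namespace DyadicSystem

variable {X : Type*} [MeasurableSpace X] [TopologicalSpace X] {μ : Measure X}
  {ι : Type*} {N : ℝ≥0} (D : DyadicSystem μ ι N)

/-- The cell of generation `n` containing `z`. -/
def cell (n : ℤ) (z : X) : Set X := D.idx n ⁻¹' {D.idx n z}

theorem measurableSet_cell (n : ℤ) (z : X) : MeasurableSet (D.cell n z) :=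
  D.measurableSet_fiber n _

theorem mem_cell_self (n : ℤ) (z : X) : z ∈ D.cell n z := rfl

theorem cell_eq {n : ℤ} {z w : X} (h : w ∈ D.cell n z) : D.cell n w = D.cell n z := by
  have h' : D.idx n w = D.idx n z := h
  simp only [cell, h']

theorem cell_succ_subset (n : ℤ) (z : X) : D.cell (n + 1) z ⊆ D.cell n z :=
  fun w hw => D.nested n w z hw

/-- The cells on which `P` holds and which are maximal with this property. -/
def maximalCells (P : Set X → Prop) : Set (Set X) :=
  {Q | ∃ n z, Q = D.cell n z ∧ P (D.cell n z) ∧ ∀ m < n, ¬ P (D.cell m z)}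

theorem countable_maximalCells [Countable ι] (P : Set X → Prop) :
    (D.maximalCells P).Countable := by
  refine (countable_range (fun a : ℤ × ι => D.idx a.1 ⁻¹' {a.2})).mono ?_
  rintro Q ⟨n, z, rfl, -, -⟩
  exact ⟨(n, D.idx n z), rfl⟩

theorem pairwiseDisjoint_maximalCells (P : Set X → Prop) :
    (D.maximalCells P).PairwiseDisjoint id := by
  rintro _ ⟨n, z, rfl, hP, hn⟩ _ ⟨m, w, rfl, hP', hm⟩ hne
  refine Set.disjoint_left.2 fun x hx hx' => hne ?_
  simp only [id] at hx hx'
  -- By nesting, a point of a maximal cell has the same coarser cells as the centre, so both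
  -- maximality conditions can be read at the common point `x`. They then force equal generations.
  have aux : ∀ {n : ℤ} {z : X}, x ∈ D.cell n z → (∀ m < n, ¬ P (D.cell m z)) →
      ∀ m < n, ¬ P (D.cell m x) := by
    intro n z hx h m hmn
    have : ∀ k : ℕ, x ∈ D.cell (n - k) z := by
      intro k
      induction k with
      | zero => simpa using hx
      | succ k ih =>
        apply D.cell_succ_subset
        convert ih using 2
        push_cast; ring
    have := this (n - m).toNat
    rw [show n - ((n - m).toNat : ℤ) = m by omega] at this
    rw [D.cell_eq this]
    exact h m hmn
  have h1 := aux hx hn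
  have h2 := aux hx' hm
  rw [← D.cell_eq hx] at hP ⊢
  rw [← D.cell_eq hx'] at hP' ⊢
  rcases lt_trichotomy n m with h | h | h
  · exact absurd hP (h2 _ h)
  · rw [h]
  · exact absurd hP' (h1 _ h)

theorem measurableSet_of_mem_maximalCells {P : Set X → Prop} {Q : Set X}
    (hQ : Q ∈ D.maximalCells P) : MeasurableSet Q := by
  obtain ⟨n, z, rfl, -, -⟩ := hQ
  exact D.measurableSet_cell n z

theorem mem_sUnion_maximalCells {P : Set X → Prop} {z : X}
    (hP : ∃ n₀, ∀ n ≤ n₀, ¬ P (D.cell n z)) {n : ℤ} (hn : P (D.cell n z)) :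
    z ∈ ⋃₀ D.maximalCells P := by
  obtain ⟨n₀, h₀⟩ := hP
  obtain ⟨m, hm, hmin⟩ := Int.exists_least_of_bdd (P := fun n => P (D.cell n z))
    ⟨n₀, fun k hk => by
      by_contra h
      exact h₀ k (by omega) hk⟩ ⟨n, hn⟩
  refine ⟨D.cell m z, ⟨m, z, rfl, hm, fun k hk h => ?_⟩, D.mem_cell_self m z⟩
  exact absurd (hmin k h) (by omega)

theorem lintegral_sUnion_maximalCells [Countable ι] (P : Set X → Prop) (G : X → ℝ≥0∞) :
    ∫⁻ z in ⋃₀ D.maximalCells P, G z ∂μ = ∑' Q : D.maximalCells P, ∫⁻ z in Q, G z ∂μ := by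
  rw [sUnion_eq_biUnion]
  exact lintegral_biUnion (D.countable_maximalCells P)
    (fun Q hQ => D.measurableSet_of_mem_maximalCells hQ) (D.pairwiseDisjoint_maximalCells P) G

/-- A differentiation theorem: a bound for all dyadic averages is a pointwise bound. -/
theorem ae_le_of_forall_setLIntegral_le [Countable ι] [BorelSpace X] [μ.OuterRegular]
    {G : X → ℝ≥0∞}
    (hG : Measurable G) (hG' : ∫⁻ z, G z ∂μ ≠ ⊤) (τ : ℝ≥0) :
    ∀ᵐ z ∂μ, (∀ n, ∫⁻ w in D.cell n z, G w ∂μ ≤ τ * μ (D.cell n z)) → G z ≤ τ := by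
  set A : Set X := {z | ∀ n, ∫⁻ w in D.cell n z, G w ∂μ ≤ τ * μ (D.cell n z)} with hA
  have key : ∀ σ : ℝ≥0, τ < σ → μ (A ∩ {z | (σ : ℝ≥0∞) ≤ G z}) = 0 := by
    intro σ hσ
    have hσ0 : (σ : ℝ≥0∞) ≠ 0 := by
      simpa using (lt_of_le_of_lt (zero_le) hσ).ne'
    set B := A ∩ {z | (σ : ℝ≥0∞) ≤ G z} with hB
    have hmeas : MeasurableSet {z | (σ : ℝ≥0∞) ≤ G z} := measurableSet_le measurable_const hG
    have hBfin : μ B ≠ ⊤ := by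
      refine ((measure_mono inter_subset_right).trans_lt ?_).ne
      exact (meas_ge_le_lintegral_div hG.aemeasurable hσ0 (by simp)).trans_lt
        (ENNReal.div_lt_top hG' hσ0)
    -- Cover `B` by the maximal cells that lie in `U` and meet `B`. Each is the cell of one of its
    -- points in `A`, so the average of `G` over it is at most `τ`, while `G ≥ σ` on `B`. Outer
    -- regularity then shrinks `U` to `B` and gives `σ μ(B) ≤ τ μ(B)`, impossible for `σ > τ` unless
    -- `B` is null.
    have hle : ∀ U, B ⊆ U → IsOpen U → μ U ≠ ⊤ → σ * μ B ≤ τ * μ U := by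
      intro U hBU hU hUfin
      set P : Set X → Prop := fun Q => Q ⊆ U ∧ (Q ∩ B).Nonempty with hP
      have hsub : B ⊆ ⋃₀ D.maximalCells P := by
        intro z hz
        obtain ⟨n, hn⟩ := D.shrinking z U (hU.mem_nhds (hBU hz))
        refine D.mem_sUnion_maximalCells ?_ (n := n) ⟨hn, z, D.mem_cell_self n z, hz⟩
        obtain ⟨n₀, h₀⟩ := D.large z (μ U).toNNReal
        refine ⟨n₀, fun n hn h => ?_⟩
        have h1 := h₀ n hn
        rw [ENNReal.coe_toNNReal hUfin] at h1
        exact absurd (measure_mono h.1) (not_le.2 h1)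
      calc σ * μ B ≤ σ * μ ((⋃₀ D.maximalCells P) ∩ {z | (σ : ℝ≥0∞) ≤ G z}) := by
            gcongr
            exact fun z hz => ⟨hsub hz, hz.2⟩
        _ ≤ ∫⁻ z in ⋃₀ D.maximalCells P, G z ∂μ := by
            have := mul_meas_ge_le_lintegral₀ (μ := μ.restrict (⋃₀ D.maximalCells P))
              hG.aemeasurable (σ : ℝ≥0∞)
            rwa [Measure.restrict_apply hmeas, inter_comm] at this
        _ = ∑' Q : D.maximalCells P, ∫⁻ z in Q, G z ∂μ :=
            D.lintegral_sUnion_maximalCells P G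
        _ ≤ ∑' Q : D.maximalCells P, τ * μ Q := by
            refine ENNReal.tsum_le_tsum ?_
            rintro ⟨Q, n, z, rfl, ⟨-, w, hw, hwB⟩, -⟩
            simp only
            rw [← D.cell_eq hw]
            exact hwB.1 n
        _ = τ * μ (⋃₀ D.maximalCells P) := by
            rw [ENNReal.tsum_mul_left, measure_sUnion (D.countable_maximalCells P)
              (D.pairwiseDisjoint_maximalCells P)
              (fun Q hQ => D.measurableSet_of_mem_maximalCells hQ)]
        _ ≤ τ * μ U := by
            gcongr
            rintro z ⟨Q, ⟨n, w, rfl, h, -⟩, hz⟩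
            exact h.1 hz
    have h2 : σ * μ B ≤ τ * μ B := by
      rcases eq_or_ne τ 0 with h0 | h0
      · obtain ⟨U, hU, hUo, hUl⟩ := B.exists_isOpen_lt_of_lt (μ := μ) (μ B + 1)
          (ENNReal.lt_add_right hBfin one_ne_zero)
        have := hle U hU hUo (hUl.trans_le le_top).ne
        simpa [h0] using this
      · refine ENNReal.le_of_forall_pos_le_add fun ε hε _ => ?_
        have hδ : (ε / τ : ℝ≥0∞) ≠ 0 := by
          simp [hε.ne']
        obtain ⟨U, hU, hUo, hUl⟩ := B.exists_isOpen_lt_of_lt (μ := μ) (μ B + ε / τ)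
          (ENNReal.lt_add_right hBfin hδ)
        refine (hle U hU hUo (hUl.trans_le le_top).ne).trans ?_
        calc (τ : ℝ≥0∞) * μ U ≤ τ * (μ B + ε / τ) := by gcongr
          _ = τ * μ B + ε := by
            rw [mul_add, ENNReal.mul_div_cancel (by simpa using h0) (by simp)]
    by_contra h0
    have := (ENNReal.mul_le_mul_iff_left h0 hBfin).1 h2
    exact absurd hσ (not_lt.2 (by exact_mod_cast this))
  have hall : ∀ᵐ z ∂μ, ∀ k : ℕ, ¬ z ∈ A ∩ {z | ((τ + 1 / (k + 1) : ℝ≥0) : ℝ≥0∞) ≤ G z} := by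
    rw [ae_all_iff]
    intro k
    exact measure_eq_zero_iff_ae_notMem.1 (key _ (lt_add_of_pos_right _ (by positivity)))
  filter_upwards [hall] with z hz hzA
  refine ENNReal.le_of_forall_pos_le_add fun ε hε _ => ?_
  obtain ⟨k, hk⟩ := exists_nat_one_div_lt hε
  have := hz k
  simp only [mem_inter_iff, mem_ofPred_eq, not_and, not_le] at this
  refine (this hzA).le.trans ?_
  rw [← ENNReal.coe_add]
  exact ENNReal.coe_le_coe.2 (add_le_add_right hk.le τ)

end DyadicSystem

/-- Calderón–Zygmund stopping: an estimate of the excess of `G` over `C τ` on the cells where the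
average of `G` is comparable to `τ` gives a global estimate of this excess. -/
theorem DyadicSystem.lintegral_tsub_le {X : Type*} [MeasurableSpace X] [TopologicalSpace X]
    [BorelSpace X] {μ : Measure X} [μ.OuterRegular] {ι : Type*} [Countable ι] {N : ℝ≥0}
    (D : DyadicSystem μ ι N) {G W : X → ℝ≥0∞} (hG : Measurable G) (hG' : ∫⁻ z, G z ∂μ ≠ ⊤)
    {τ C β : ℝ≥0} (hτ : 0 < τ) (hC : 1 ≤ C)
    (hcell : ∀ n z, τ * μ (D.cell n z) < ∫⁻ w in D.cell n z, G w ∂μ →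
      ∫⁻ w in D.cell n z, G w ∂μ ≤ N * τ * μ (D.cell n z) →
      ∫⁻ w in D.cell n z, (G w - C * τ) ∂μ
        ≤ ∫⁻ w in D.cell n z, W w ∂μ + β * (τ * μ (D.cell n z))) :
    ∫⁻ z, (G z - C * τ) ∂μ
      ≤ ∫⁻ z, W z ∂μ + 2 * β * ∫⁻ z, {z | (τ : ℝ≥0∞) < 2 * G z}.indicator G z ∂μ := by
  classical
  set P : Set X → Prop := fun Q => τ * μ Q < ∫⁻ w in Q, G w ∂μ with hP
  have hbdd : ∀ z, ∃ n₀, ∀ n ≤ n₀, ¬ P (D.cell n z) := by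
    intro z
    obtain ⟨n₀, h₀⟩ := D.large z ((∫⁻ z, G z ∂μ) / τ).toNNReal
    have hτ' : (τ : ℝ≥0∞) ≠ 0 := by simpa using hτ.ne'
    refine ⟨n₀, fun n hn h => ?_⟩
    have h1 := h₀ n hn
    rw [ENNReal.coe_toNNReal (ENNReal.div_lt_top hG' hτ').ne] at h1
    refine absurd (h.le.trans (setLIntegral_le_lintegral _ _)) (not_le.2 ?_)
    rw [mul_comm]
    exact (ENNReal.div_lt_iff (Or.inl hτ') (Or.inl ENNReal.coe_ne_top)).1 h1
  set Ω := ⋃₀ D.maximalCells P with hΩ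
  have hΩm : MeasurableSet Ω := MeasurableSet.sUnion (D.countable_maximalCells P)
    fun Q hQ => D.measurableSet_of_mem_maximalCells hQ
  -- Off the stopping cells all averages are at most `τ`, hence `G ≤ τ ≤ C τ` almost everywhere
  -- there.
  have hout : ∫⁻ z in Ωᶜ, (G z - C * τ) ∂μ = 0 := by
    rw [lintegral_eq_zero_iff (by fun_prop)]
    have := D.ae_le_of_forall_setLIntegral_le hG hG' τ
    filter_upwards [ae_restrict_of_ae this, ae_restrict_mem hΩm.compl] with z hz hzΩ
    have hz1 : G z ≤ τ := by
      refine hz fun n => ?_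
      by_contra h
      exact hzΩ (D.mem_sUnion_maximalCells (hbdd z) (n := n) (not_le.1 h))
    refine tsub_eq_zero_of_le (hz1.trans ?_)
    calc (τ : ℝ≥0∞) = 1 * τ := (one_mul _).symm
      _ ≤ C * τ := by gcongr; exact_mod_cast hC
  have hmeasE : MeasurableSet {z | (τ : ℝ≥0∞) < 2 * G z} :=
    measurableSet_lt measurable_const (hG.const_mul 2)
  have hone : ∀ Q ∈ D.maximalCells P, ∫⁻ w in Q, (G w - C * τ) ∂μ
      ≤ ∫⁻ w in Q, W w ∂μ
        + 2 * β * ∫⁻ w in Q, {z | (τ : ℝ≥0∞) < 2 * G z}.indicator G w ∂μ := by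
    rintro _ ⟨n, z, rfl, hPn, hmin⟩
    have hfin : μ (D.cell n z) ≠ ⊤ := D.measure_ne_top n z
    -- The parent cell was not selected, and it is at most `N` times as large.
    have h1 : ∫⁻ w in D.cell n z, G w ∂μ ≤ N * τ * μ (D.cell n z) := by
      have h2 : D.cell n z ⊆ D.cell (n - 1) z := by
        simpa using D.cell_succ_subset (n - 1) z
      calc ∫⁻ w in D.cell n z, G w ∂μ ≤ ∫⁻ w in D.cell (n - 1) z, G w ∂μ :=
            lintegral_mono_set h2
        _ ≤ τ * μ (D.cell (n - 1) z) := not_lt.1 (hmin (n - 1) (by omega))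
        _ ≤ τ * (N * μ (D.cell n z)) := by
            gcongr
            have := D.doubling (n - 1) z
            rwa [sub_add_cancel] at this
        _ = _ := by ring
    refine (hcell n z hPn h1).trans ?_
    rw [mul_comm 2 (β : ℝ≥0∞), mul_assoc]
    refine add_le_add_right (mul_le_mul_right ?_ _) _
    -- The part of the cell where `2 G ≤ τ` contributes at most `τ μ(Q)` to `2 ∫_Q G`, which itself
    -- is at least `2 τ μ(Q)`. Hence `τ μ(Q) ≤ 2 ∫_{Q ∩ {2G > τ}} G`, which is what charges the
    -- error term to the set where `G` is large.
    have hsplit : ∫⁻ w in D.cell n z, 2 * G w ∂μ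
        ≤ 2 * ∫⁻ w in D.cell n z, {z | (τ : ℝ≥0∞) < 2 * G z}.indicator G w ∂μ
          + τ * μ (D.cell n z) := by
      rw [← lintegral_const_mul _ (hG.indicator hmeasE), ← setLIntegral_const,
        ← lintegral_add_right _ measurable_const]
      refine lintegral_mono fun w => ?_
      by_cases hw : (τ : ℝ≥0∞) < 2 * G w
      · simp [indicator, hw]
      · simp [indicator, hw, not_lt.1 hw]
    rw [lintegral_const_mul _ hG] at hsplit
    have h3 : 2 * (τ * μ (D.cell n z))
        ≤ 2 * ∫⁻ w in D.cell n z, {z | (τ : ℝ≥0∞) < 2 * G z}.indicator G w ∂μ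
          + τ * μ (D.cell n z) := by
      refine le_trans ?_ hsplit
      exact mul_le_mul_right hPn.le 2
    rw [two_mul (τ * μ (D.cell n z))] at h3
    have hne : τ * μ (D.cell n z) ≠ ⊤ := ENNReal.mul_ne_top ENNReal.coe_ne_top hfin
    exact (ENNReal.add_le_add_iff_right hne).1 h3
  have hmeasI : Measurable (fun z => {z | (τ : ℝ≥0∞) < 2 * G z}.indicator G z) :=
    hG.indicator hmeasE
  calc ∫⁻ z, (G z - C * τ) ∂μ = ∫⁻ z in Ω, (G z - C * τ) ∂μ := by
        rw [← lintegral_add_compl _ hΩm, hout, add_zero]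
    _ = ∑' Q : D.maximalCells P, ∫⁻ z in Q, (G z - C * τ) ∂μ :=
        D.lintegral_sUnion_maximalCells P _
    _ ≤ ∑' Q : D.maximalCells P, (∫⁻ w in Q, W w ∂μ
        + 2 * β * ∫⁻ w in Q, {z | (τ : ℝ≥0∞) < 2 * G z}.indicator G w ∂μ) :=
        ENNReal.tsum_le_tsum fun Q => hone Q Q.2
    _ = ∫⁻ z in Ω, W z ∂μ
        + 2 * β * ∫⁻ z in Ω, {z | (τ : ℝ≥0∞) < 2 * G z}.indicator G z ∂μ := by
        rw [ENNReal.tsum_add, ENNReal.tsum_mul_left, D.lintegral_sUnion_maximalCells P W,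
          D.lintegral_sUnion_maximalCells P]
    _ ≤ _ := by gcongr <;> exact Measure.restrict_le_self

/-! ### From excess estimates at every level to power bounds. -/

theorem lintegral_rpow_Ioo {s m : ℝ} (hs : 0 < s) (hm : 0 ≤ m) :
    ∫⁻ τ in Ioo 0 m, ENNReal.ofReal (τ ^ (s - 1)) = ENNReal.ofReal s⁻¹ * ENNReal.ofReal m ^ s := by
  have hint : IntegrableOn (fun τ : ℝ => τ ^ (s - 1)) (Ioo 0 m) := by
    rw [← intervalIntegrable_iff_integrableOn_Ioo_of_le hm]
    exact intervalIntegral.intervalIntegrable_rpow' (by linarith)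
  rw [← ofReal_integral_eq_lintegral_ofReal hint, ← integral_Ioc_eq_integral_Ioo,
    ← intervalIntegral.integral_of_le hm, integral_rpow (Or.inl (by linarith)),
    ENNReal.ofReal_rpow_of_nonneg hm hs.le, ← ENNReal.ofReal_mul (by positivity)]
  · congr 1
    rw [sub_add_cancel, Real.zero_rpow hs.ne']
    ring
  · filter_upwards [ae_restrict_mem measurableSet_Ioo] with τ hτ
    exact Real.rpow_nonneg hτ.1.le _

/-- The integral of the weight `τ^(s-1)` over `0 < τ < min c Λ`. -/
theorem lintegral_rpow_indicator {s Λ : ℝ} (hs : 0 < s) (c : ℝ≥0∞) :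
    ∫⁻ τ in Ioo 0 Λ, {τ : ℝ | ENNReal.ofReal τ < c}.indicator
        (fun τ => ENNReal.ofReal (τ ^ (s - 1))) τ
      = ENNReal.ofReal s⁻¹ * (min c (ENNReal.ofReal Λ)) ^ s := by
  have hmeas : MeasurableSet {τ : ℝ | ENNReal.ofReal τ < c} :=
    measurableSet_lt ENNReal.measurable_ofReal measurable_const
  have hfin : min c (ENNReal.ofReal Λ) ≠ ⊤ :=
    ((min_le_right _ _).trans_lt ENNReal.ofReal_lt_top).ne
  rw [lintegral_indicator hmeas, Measure.restrict_restrict hmeas]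
  have hset : {τ : ℝ | ENNReal.ofReal τ < c} ∩ Ioo 0 Λ
      = Ioo 0 (min c (ENNReal.ofReal Λ)).toReal := by
    ext τ
    simp only [mem_inter_iff, mem_ofPred_eq, mem_Ioo]
    constructor
    · rintro ⟨h1, h2, h3⟩
      refine ⟨h2, (ENNReal.ofReal_lt_iff_lt_toReal h2.le hfin).1 (lt_min h1 ?_)⟩
      exact (ENNReal.ofReal_lt_ofReal_iff_of_nonneg h2.le).2 h3
    · rintro ⟨h1, h2⟩
      have := (ENNReal.ofReal_lt_iff_lt_toReal h1.le hfin).2 h2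
      exact ⟨this.trans_le (min_le_left _ _), h1,
        (ENNReal.ofReal_lt_ofReal_iff_of_nonneg h1.le).1 (this.trans_le (min_le_right _ _))⟩
  rw [hset, lintegral_rpow_Ioo hs ENNReal.toReal_nonneg, ENNReal.ofReal_toReal hfin]

section RealVariable

variable {X : Type*} [MeasurableSpace X] {μ : Measure X} [SFinite μ]

/-- Truncated layer-cake formula: Tonelli, then the `τ`-integral at fixed `z` over `0 < τ < min (Y
z) Λ`. -/
theorem lintegral_rpow_mul_lintegral_indicator {s Λ : ℝ} (hs : 0 < s) {H Y : X → ℝ≥0∞}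
    (hH : Measurable H) (hY : Measurable Y) :
    ∫⁻ τ in Ioo 0 Λ, ENNReal.ofReal (τ ^ (s - 1)) *
        ∫⁻ z, {z | ENNReal.ofReal τ < Y z}.indicator H z ∂μ
      = ENNReal.ofReal s⁻¹ * ∫⁻ z, H z * (min (Y z) (ENNReal.ofReal Λ)) ^ s ∂μ := by
  have hm : Measurable (fun x : ℝ × X => ENNReal.ofReal (x.1 ^ (s - 1)) *
      {z | ENNReal.ofReal x.1 < Y z}.indicator H x.2) := by
    have : Measurable (fun x : ℝ × X =>
        {x : ℝ × X | ENNReal.ofReal x.1 < Y x.2}.indicator (fun x => H x.2) x) := by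
      refine Measurable.indicator (by fun_prop) ?_
      exact measurableSet_lt (by fun_prop) (by fun_prop)
    exact Measurable.mul (by fun_prop) this
  have h1 : ∀ τ : ℝ, ENNReal.ofReal (τ ^ (s - 1)) *
        ∫⁻ z, {z | ENNReal.ofReal τ < Y z}.indicator H z ∂μ
      = ∫⁻ z, ENNReal.ofReal (τ ^ (s - 1)) * {z | ENNReal.ofReal τ < Y z}.indicator H z ∂μ := by
    intro τ
    rw [lintegral_const_mul _ (hH.indicator (measurableSet_lt measurable_const hY))]
  simp_rw [h1]
  rw [lintegral_lintegral_swap hm.aemeasurable, ← lintegral_const_mul _ (by fun_prop)]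
  refine lintegral_congr fun z => ?_
  have h2 : ∀ τ : ℝ, ENNReal.ofReal (τ ^ (s - 1)) *
      {z | ENNReal.ofReal τ < Y z}.indicator H z
      = H z * {τ : ℝ | ENNReal.ofReal τ < Y z}.indicator
        (fun τ => ENNReal.ofReal (τ ^ (s - 1))) τ := by
    intro τ
    by_cases h : ENNReal.ofReal τ < Y z <;> simp [indicator, h, mul_comm]
  simp_rw [h2]
  rw [lintegral_const_mul _ (Measurable.indicator (by fun_prop)
    (measurableSet_lt (by fun_prop) measurable_const)), lintegral_rpow_indicator hs]
  ring

/-- Integrate the excess estimate against `τ^(s-1)` over `(0, Λ)`. On the left, `G - C τ ≥ G / 2` as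
soon as `τ < G / (2C)`, which gives at least `J / (2 (2C)^s)` up to the factor `1/s`. On the right,
the `G`-term gives `b η 2^s J`. The condition `hη'` says exactly that this is at most half of the
left side. -/
theorem lintegral_truncated_rpow_le {s : ℝ} (hs : 0 < s) {C a b η : ℝ≥0} (hC : 1 ≤ C)
    (hη : 0 < η) (hη' : b * η * (2 * 2 ^ s * (2 * C) ^ s) ≤ 1 / 2)
    {G U : X → ℝ≥0∞} (hG : Measurable G) (hU : Measurable U) (hG' : ∫⁻ z, G z ∂μ ≠ ⊤)
    (h : ∀ τ : ℝ≥0, 0 < τ → ∫⁻ z, (G z - C * τ) ∂μ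
      ≤ a * ∫⁻ z, {z | (η * τ : ℝ≥0∞) < U z}.indicator U z ∂μ
        + b * η * ∫⁻ z, {z | (τ : ℝ≥0∞) < 2 * G z}.indicator G z ∂μ) (Λ : ℝ) :
    ∫⁻ z, G z * (min (G z) (ENNReal.ofReal Λ)) ^ s ∂μ
      ≤ 2 * (2 * (2 * C) ^ s * a * (η⁻¹) ^ s : ℝ≥0) * ∫⁻ z, U z ^ (1 + s) ∂μ := by
  set J := ∫⁻ z, G z * (min (G z) (ENNReal.ofReal Λ)) ^ s ∂μ with hJ
  set I := ∫⁻ z, U z ^ (1 + s) ∂μ with hI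
  have hs' : ENNReal.ofReal s⁻¹ ≠ 0 := by simpa using hs
  have hC0 : (2 * C : ℝ≥0∞) ≠ 0 := by simpa using (zero_lt_one.trans_le hC).ne'
  have hCt : (2 * C : ℝ≥0∞) ≠ ⊤ := by finiteness
  -- The cutoff `Λ` serves this purpose: only a finite `J` may be subtracted from both sides.
  have hJfin : J ≠ ⊤ := by
    refine ((lintegral_mono fun z => mul_le_mul_right
      (ENNReal.rpow_le_rpow (min_le_right _ _) hs.le) (G z)).trans_lt ?_).ne
    rw [lintegral_mul_const _ hG]
    exact ENNReal.mul_lt_top hG'.lt_top (ENNReal.rpow_lt_top_of_nonneg hs.le ENNReal.ofReal_ne_top)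
  -- lower bound of the left side
  have hlow : ENNReal.ofReal s⁻¹ * ((2 * (2 * C) ^ s : ℝ≥0∞)⁻¹ * J)
      ≤ ∫⁻ τ in Ioo 0 Λ, ENNReal.ofReal (τ ^ (s - 1)) *
        ∫⁻ z, (G z - C * ENNReal.ofReal τ) ∂μ := by
    calc ENNReal.ofReal s⁻¹ * ((2 * (2 * C) ^ s : ℝ≥0∞)⁻¹ * J)
        ≤ ENNReal.ofReal s⁻¹ *
          ∫⁻ z, (G z / 2) * (min (G z / (2 * C)) (ENNReal.ofReal Λ)) ^ s ∂μ := by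
          rw [hJ, ← lintegral_const_mul _ (by fun_prop)]
          refine mul_le_mul_right (lintegral_mono fun z => ?_) _
          have h1 : min (G z) (ENNReal.ofReal Λ) / (2 * C)
              ≤ min (G z / (2 * C)) (ENNReal.ofReal Λ) := by
            refine le_min (by gcongr; exact min_le_left _ _) ?_
            refine ENNReal.div_le_of_le_mul ((min_le_right _ _).trans ?_)
            refine le_mul_of_one_le_right (zero_le) ?_
            calc (1 : ℝ≥0∞) ≤ C := by exact_mod_cast hC
              _ ≤ 2 * C := le_mul_of_one_le_left zero_le (by norm_num)
          refine le_trans (le_of_eq ?_) (mul_le_mul_right (ENNReal.rpow_le_rpow h1 hs.le) _)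
          rw [ENNReal.div_rpow_of_nonneg _ _ hs.le, ENNReal.mul_inv (by simp) (by simp),
            div_eq_mul_inv, div_eq_mul_inv]
          ring
      _ = ∫⁻ τ in Ioo 0 Λ, ENNReal.ofReal (τ ^ (s - 1)) *
          ∫⁻ z, {z | ENNReal.ofReal τ < G z / (2 * C)}.indicator (fun z => G z / 2) z ∂μ :=
          (lintegral_rpow_mul_lintegral_indicator hs (by fun_prop) (by fun_prop)).symm
      _ ≤ _ := by
          gcongr with τ z
          by_cases hτ : ENNReal.ofReal τ < G z / (2 * C)
          · simp only [indicator, mem_ofPred_eq, hτ, if_true]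
            have h2 : C * ENNReal.ofReal τ ≤ G z / 2 := by
              rw [ENNReal.le_div_iff_mul_le (by simp) (by simp)]
              calc C * ENNReal.ofReal τ * 2 = ENNReal.ofReal τ * (2 * C) := by ring
                _ ≤ G z := (ENNReal.le_div_iff_mul_le (Or.inl hC0) (Or.inl hCt)).1 hτ.le
            refine ENNReal.le_sub_of_add_le_right (by finiteness) ?_
            calc G z / 2 + C * ENNReal.ofReal τ ≤ G z / 2 + G z / 2 := by gcongr
              _ = G z := ENNReal.add_halves _
          · simp [indicator, hτ]
  have hη0 : (η : ℝ≥0∞) ≠ 0 := by simpa using hη.ne'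
  have hup : ∫⁻ τ in Ioo 0 Λ, ENNReal.ofReal (τ ^ (s - 1)) *
        ∫⁻ z, (G z - C * ENNReal.ofReal τ) ∂μ
      ≤ ENNReal.ofReal s⁻¹ * (a * (η⁻¹ : ℝ≥0∞) ^ s * I + b * η * 2 ^ s * J) := by
    have m1 : Measurable fun τ : ℝ =>
        ∫⁻ z, {z | ENNReal.ofReal τ < (η⁻¹ : ℝ≥0∞) * U z}.indicator U z ∂μ := by
      refine Measurable.lintegral_prod_right' (f := fun x : ℝ × X =>
        {x : ℝ × X | ENNReal.ofReal x.1 < (η⁻¹ : ℝ≥0∞) * U x.2}.indicator (fun x => U x.2) x) ?_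
      exact Measurable.indicator (by fun_prop) (measurableSet_lt (by fun_prop) (by fun_prop))
    have m2 : Measurable fun τ : ℝ =>
        ∫⁻ z, {z | ENNReal.ofReal τ < 2 * G z}.indicator G z ∂μ := by
      refine Measurable.lintegral_prod_right' (f := fun x : ℝ × X =>
        {x : ℝ × X | ENNReal.ofReal x.1 < 2 * G x.2}.indicator (fun x => G x.2) x) ?_
      exact Measurable.indicator (by fun_prop) (measurableSet_lt (by fun_prop) (by fun_prop))
    calc ∫⁻ τ in Ioo 0 Λ, ENNReal.ofReal (τ ^ (s - 1)) *
        ∫⁻ z, (G z - C * ENNReal.ofReal τ) ∂μ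
        ≤ ∫⁻ τ in Ioo 0 Λ, (a * (ENNReal.ofReal (τ ^ (s - 1)) *
            ∫⁻ z, {z | ENNReal.ofReal τ < (η⁻¹ : ℝ≥0∞) * U z}.indicator U z ∂μ)
          + b * η * (ENNReal.ofReal (τ ^ (s - 1)) *
            ∫⁻ z, {z | ENNReal.ofReal τ < 2 * G z}.indicator G z ∂μ)) := by
          refine setLIntegral_mono' measurableSet_Ioo fun τ hτ => ?_
          have h3 := h τ.toNNReal (Real.toNNReal_pos.2 hτ.1)
          have h4 : {z | (η * (τ.toNNReal : ℝ≥0∞) : ℝ≥0∞) < U z}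
              = {z | ENNReal.ofReal τ < (η⁻¹ : ℝ≥0∞) * U z} := by
            ext z
            simp only [mem_ofPred_eq]
            rw [mul_comm (η⁻¹ : ℝ≥0∞), ← div_eq_mul_inv,
              ENNReal.lt_div_iff_mul_lt (Or.inl hη0) (Or.inl ENNReal.coe_ne_top), mul_comm]
            rfl
          rw [h4] at h3
          refine (mul_le_mul_right h3 _).trans (le_of_eq ?_)
          simp only [ENNReal.ofReal]
          ring
      _ = a * (ENNReal.ofReal s⁻¹ *
            ∫⁻ z, U z * (min ((η⁻¹ : ℝ≥0∞) * U z) (ENNReal.ofReal Λ)) ^ s ∂μ)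
          + b * η * (ENNReal.ofReal s⁻¹ *
            ∫⁻ z, G z * (min (2 * G z) (ENNReal.ofReal Λ)) ^ s ∂μ) := by
          rw [lintegral_add_left (by fun_prop), lintegral_const_mul _ (by fun_prop),
            lintegral_const_mul _ (by fun_prop),
            lintegral_rpow_mul_lintegral_indicator hs hU (by fun_prop),
            lintegral_rpow_mul_lintegral_indicator hs hG (by fun_prop)]
      _ ≤ a * (ENNReal.ofReal s⁻¹ * ((η⁻¹ : ℝ≥0∞) ^ s * I))
          + b * η * (ENNReal.ofReal s⁻¹ * (2 ^ s * J)) := by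
          have e1 : ∫⁻ z, U z * (min ((η⁻¹ : ℝ≥0∞) * U z) (ENNReal.ofReal Λ)) ^ s ∂μ
              ≤ (η⁻¹ : ℝ≥0∞) ^ s * I := by
            rw [hI, ← lintegral_const_mul _ (by fun_prop)]
            refine lintegral_mono fun z => ?_
            rw [ENNReal.rpow_add_of_nonneg _ _ zero_le_one hs.le, ENNReal.rpow_one]
            refine (mul_le_mul_right (ENNReal.rpow_le_rpow (min_le_left _ _) hs.le) _).trans
              (le_of_eq ?_)
            rw [ENNReal.mul_rpow_of_nonneg _ _ hs.le]
            ring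
          have e2 : ∫⁻ z, G z * (min (2 * G z) (ENNReal.ofReal Λ)) ^ s ∂μ ≤ 2 ^ s * J := by
            rw [hJ, ← lintegral_const_mul _ (by fun_prop)]
            refine lintegral_mono fun z => ?_
            have h5 : min (2 * G z) (ENNReal.ofReal Λ) ≤ 2 * min (G z) (ENNReal.ofReal Λ) := by
              rw [mul_min]
              exact min_le_min le_rfl (le_mul_of_one_le_left zero_le (by norm_num))
            refine (mul_le_mul_right (ENNReal.rpow_le_rpow h5 hs.le) _).trans (le_of_eq ?_)
            rw [ENNReal.mul_rpow_of_nonneg _ _ hs.le]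
            ring
          gcongr
      _ = _ := by ring
  have hmain : (2 * (2 * C) ^ s : ℝ≥0∞)⁻¹ * J
      ≤ a * (η⁻¹ : ℝ≥0∞) ^ s * I + b * η * 2 ^ s * J :=
    (ENNReal.mul_le_mul_iff_right hs' ENNReal.ofReal_ne_top).1 (hlow.trans hup)
  have hc0 : (2 * (2 * C) ^ s : ℝ≥0∞) ≠ 0 := by
    refine mul_ne_zero (by simp) ?_
    exact (ENNReal.rpow_pos (pos_iff_ne_zero.2 hC0) hCt).ne'
  have hct : (2 * (2 * C) ^ s : ℝ≥0∞) ≠ ⊤ := by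
    exact ENNReal.mul_ne_top (by simp) (ENNReal.rpow_ne_top_of_nonneg hs.le hCt)
  have hmain2 : J ≤ (2 * (2 * C) ^ s * a * (η⁻¹) ^ s : ℝ≥0) * I + J / 2 := by
    calc J = (2 * (2 * C) ^ s : ℝ≥0∞) * ((2 * (2 * C) ^ s : ℝ≥0∞)⁻¹ * J) := by
          rw [← mul_assoc, ENNReal.mul_inv_cancel hc0 hct, one_mul]
      _ ≤ (2 * (2 * C) ^ s : ℝ≥0∞) * (a * (η⁻¹ : ℝ≥0∞) ^ s * I + b * η * 2 ^ s * J) := by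
          gcongr
      _ = (2 * (2 * C) ^ s * a * (η⁻¹) ^ s : ℝ≥0) * I
          + (b * η * (2 * 2 ^ s * (2 * C) ^ s) : ℝ≥0) * J := by
          push_cast
          rw [ENNReal.coe_rpow_of_nonneg _ hs.le, ENNReal.coe_rpow_of_nonneg _ hs.le,
            ENNReal.coe_rpow_of_nonneg _ hs.le, ENNReal.coe_inv hη.ne']
          push_cast
          ring
      _ ≤ _ := by
          gcongr
          rw [div_eq_mul_inv, mul_comm J]
          gcongr
          calc ((b * η * (2 * 2 ^ s * (2 * C) ^ s) : ℝ≥0) : ℝ≥0∞) ≤ ((1 / 2 : ℝ≥0) : ℝ≥0∞) :=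
                ENNReal.coe_le_coe.2 hη'
            _ = 2⁻¹ := by simp
  have hJ2 : J / 2 ≠ ⊤ := (ENNReal.div_lt_top hJfin (by simp)).ne
  have hmain3 : J / 2 ≤ (2 * (2 * C) ^ s * a * (η⁻¹) ^ s : ℝ≥0) * I := by
    refine WithTop.le_of_add_le_add_right hJ2 ?_
    calc J / 2 + J / 2 = J := ENNReal.add_halves _
      _ ≤ _ := hmain2
  calc J = 2 * (J / 2) := (ENNReal.mul_div_cancel (by simp) (by simp)).symm
    _ ≤ 2 * ((2 * (2 * C) ^ s * a * (η⁻¹) ^ s : ℝ≥0) * I) := by gcongr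
    _ = _ := by ring

/-- The real-variable core: excess estimates at all levels give a bound in a higher power. -/
theorem exists_lintegral_rpow_le {X : Type*} [MeasurableSpace X] (μ : Measure X) [SFinite μ]
    {s : ℝ} (hs : 0 < s) {C : ℝ≥0} (a b : ℝ≥0) (hC : 1 ≤ C) :
    ∃ A η : ℝ≥0, 0 < η ∧ η ≤ 1 ∧ ∀ G U : X → ℝ≥0∞, Measurable G → Measurable U →
      ∫⁻ z, G z ∂μ ≠ ⊤ →
      (∀ τ : ℝ≥0, 0 < τ → ∫⁻ z, (G z - C * τ) ∂μ
        ≤ a * ∫⁻ z, {z | (η * τ : ℝ≥0∞) < U z}.indicator U z ∂μ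
        + b * η * ∫⁻ z, {z | (τ : ℝ≥0∞) < 2 * G z}.indicator G z ∂μ) →
      ∫⁻ z, G z ^ (1 + s) ∂μ ≤ A * ∫⁻ z, U z ^ (1 + s) ∂μ := by
  -- `η` is fixed by `a`-free data before `G` and `U` appear, since the excess hypothesis itself
  -- involves `η`. The `B + 1` avoids division by zero when `b = 0`.
  set B : ℝ≥0 := b * (2 * 2 ^ s * (2 * C) ^ s) with hB
  set η : ℝ≥0 := min 1 (1 / (2 * (B + 1))) with hη
  have hη0 : 0 < η := lt_min one_pos (by positivity)
  have hη' : b * η * (2 * 2 ^ s * (2 * C) ^ s) ≤ 1 / 2 := by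
    calc b * η * (2 * 2 ^ s * (2 * C) ^ s) = B * η := by rw [hB]; ring
      _ ≤ (B + 1) * (1 / (2 * (B + 1))) := by
        gcongr
        · exact le_self_add
        · exact min_le_right _ _
      _ = 1 / 2 := by field_simp
  refine ⟨2 * (2 * (2 * C) ^ s * a * (η⁻¹) ^ s), η, hη0, min_le_left _ _, ?_⟩
  intro G U hG hU hG' h
  have hmono : Monotone fun (n : ℕ) z => G z * (min (G z) (ENNReal.ofReal n)) ^ s := by
    intro m n hmn z
    have : ENNReal.ofReal m ≤ ENNReal.ofReal n := ENNReal.ofReal_le_ofReal (by exact_mod_cast hmn)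
    simp only
    gcongr
  -- The truncated bound is uniform in `Λ`, so monotone convergence along `Λ = n` removes the
  -- cutoff.
  have hle : ∀ᵐ z ∂μ, G z ^ (1 + s) ≤ ⨆ n : ℕ, G z * (min (G z) (ENNReal.ofReal n)) ^ s := by
    filter_upwards [ae_lt_top hG hG'] with z hz
    obtain ⟨n, hn⟩ := exists_nat_gt (G z).toReal
    refine le_trans (le_of_eq ?_) (le_iSup _ n)
    have : G z ≤ ENNReal.ofReal n := by
      rw [← ENNReal.ofReal_toReal hz.ne]
      exact ENNReal.ofReal_le_ofReal hn.le
    rw [min_eq_left this, ENNReal.rpow_add_of_nonneg _ _ zero_le_one hs.le, ENNReal.rpow_one]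
  refine (lintegral_mono_ae hle).trans ?_
  rw [lintegral_iSup (fun n => by fun_prop) hmono]
  refine iSup_le fun n => ?_
  exact_mod_cast lintegral_truncated_rpow_le hs hC hη0 hη' hG hU hG' h n

end RealVariable

/-! ### Dyadic cells adapted to the parabolic cylinders. -/

section Dyadic

variable {κ l : ℝ → ℝ}

theorem IsScalingFactor.pos (hκ : IsScalingFunction κ) (hl : IsScalingFactor κ l) {ε : ℝ}
    (hε : 0 < ε) : 0 < l ε := by
  have h := hl.scaling ε 1 hε one_pos
  have h1 := hκ.pos (ε * 1) (by positivity)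
  exact pos_of_mul_pos_left (h1.trans_le h) (hκ.pos 1 one_pos).le

/-- `κ` need not be monotone. Scaling by `r / s ≤ 1` and monotonicity of `l` give monotonicity up to
the factor `l 1`. -/
theorem IsScalingFactor.le_of_le (hκ : IsScalingFunction κ) (hl : IsScalingFactor κ l) {r s : ℝ}
    (hr : 0 < r) (hrs : r ≤ s) : κ r ≤ l 1 * κ s := by
  have hs := hr.trans_le hrs
  have h := hl.scaling (r / s) s (by positivity) hs
  rw [div_mul_cancel₀ _ hs.ne'] at h
  refine h.trans (mul_le_mul_of_nonneg_right ?_ (hκ.pos s hs).le)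
  exact hl.monotoneOn (mem_Ioi.2 (by positivity)) (mem_Ioi.2 one_pos) ((div_le_one hs).2 hrs)

/-- Dyadic time lengths comparable with `κ` along an antitone sequence of radii. -/
theorem exists_timeScale (hκ : IsScalingFunction κ) (hl : IsScalingFactor κ l) {δ : ℤ → ℝ}
    (hδ : ∀ n, 0 < δ n) (hanti : Antitone δ) :
    ∃ k : ℤ → ℤ, Monotone k ∧ (∀ n, (2 : ℝ) ^ (-k n) ≤ κ (δ n)) ∧
      ∀ n, κ (δ n) ≤ 2 * l 1 * (2 : ℝ) ^ (-k n) := by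
  have hl1 : 0 < l 1 := hl.pos hκ one_pos
  -- Asking for the bound at all larger radii `δ m`, `m ≤ n`, makes the least admissible `k`
  -- monotone in `n`, as nesting requires. Almost monotonicity of `κ` shows that this costs only the
  -- factor `l 1`, and minimality of `k` costs a further factor `2`.
  have hex : ∀ n, ∃ k : ℤ, (∀ m ≤ n, (2 : ℝ) ^ (-k) ≤ κ (δ m)) ∧
      ∀ j : ℤ, (∀ m ≤ n, (2 : ℝ) ^ (-j) ≤ κ (δ m)) → k ≤ j := by
    intro n
    refine Int.exists_least_of_bdd (P := fun k => ∀ m ≤ n, (2 : ℝ) ^ (-k) ≤ κ (δ m)) ?_ ?_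
    · obtain ⟨j, hj⟩ := pow_unbounded_of_one_lt (κ (δ n)) (one_lt_two : (1 : ℝ) < 2)
      refine ⟨-j, fun k hk => ?_⟩
      have h := (hk n le_rfl).trans_lt hj
      rw [← zpow_natCast] at h
      have := (zpow_lt_zpow_iff_right₀ (one_lt_two : (1 : ℝ) < 2)).1 h
      omega
    · obtain ⟨j, hj⟩ := exists_pow_lt_of_lt_one (div_pos (hκ.pos _ (hδ n)) hl1)
        (by norm_num : (2 : ℝ)⁻¹ < 1)
      refine ⟨j, fun m hm => ?_⟩
      rw [zpow_neg, zpow_natCast, ← inv_pow]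
      refine hj.le.trans ((div_le_iff₀ hl1).2 ?_)
      rw [mul_comm]
      exact hl.le_of_le hκ (hδ n) (hanti hm)
  choose k hk hmin using hex
  refine ⟨k, fun m n hmn => hmin m _ fun j hj => hk n j (hj.trans hmn),
    fun n => hk n n le_rfl, fun n => ?_⟩
  have h : ¬ ∀ m ≤ n, (2 : ℝ) ^ (-(k n - 1)) ≤ κ (δ m) := fun h => by
    have := hmin n _ h
    omega
  push Not at h
  obtain ⟨m, hm, hlt⟩ := h
  calc κ (δ n) ≤ l 1 * κ (δ m) := hl.le_of_le hκ (hδ n) (hanti hm)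
    _ ≤ l 1 * (2 : ℝ) ^ (-(k n - 1)) := by gcongr
    _ = _ := by
      rw [neg_sub, sub_eq_add_neg, zpow_add₀ two_ne_zero, zpow_one]
      ring

/-- Nesting of dyadic intervals: the coarse floor is the integer quotient of the fine floor by
`2^(b-a)`. -/
theorem floor_two_zpow_mul_eq {a b : ℤ} (hab : a ≤ b) {t u : ℝ}
    (h : ⌊(2 : ℝ) ^ b * t⌋ = ⌊(2 : ℝ) ^ b * u⌋) : ⌊(2 : ℝ) ^ a * t⌋ = ⌊(2 : ℝ) ^ a * u⌋ := by
  have key : ∀ t : ℝ, (2 : ℝ) ^ a * t = (2 : ℝ) ^ b * t / ((2 ^ (b - a).toNat : ℕ) : ℝ) := by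
    intro t
    have : ((2 ^ (b - a).toNat : ℕ) : ℝ) = (2 : ℝ) ^ (b - a) := by
      rw [Nat.cast_pow, Nat.cast_ofNat, ← zpow_natCast, Int.toNat_of_nonneg (by omega)]
    rw [this, zpow_sub₀ two_ne_zero]
    field_simp
  rw [key, key, Int.floor_div_natCast, Int.floor_div_natCast, h]

theorem floor_two_zpow_preimage (k i : ℤ) :
    {t : ℝ | ⌊(2 : ℝ) ^ k * t⌋ = i} = Ico (i * (2 : ℝ) ^ (-k)) ((i + 1) * (2 : ℝ) ^ (-k)) := by
  ext t
  have h2 : (0 : ℝ) < 2 ^ k := by positivity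
  rw [mem_ofPred_eq, Int.floor_eq_iff, mem_Ico, zpow_neg, ← div_eq_mul_inv, ← div_eq_mul_inv,
    div_le_iff₀ h2, lt_div_iff₀ h2, mul_comm t]

theorem volume_floor_two_zpow_preimage (k i : ℤ) :
    volume {t : ℝ | ⌊(2 : ℝ) ^ k * t⌋ = i} = ENNReal.ofReal ((2 : ℝ) ^ (-k)) := by
  rw [floor_two_zpow_preimage, Real.volume_Ico]
  congr 1
  ring

theorem abs_sub_lt_of_floor_eq {k : ℤ} {t u : ℝ}
    (h : ⌊(2 : ℝ) ^ k * t⌋ = ⌊(2 : ℝ) ^ k * u⌋) : |t - u| < (2 : ℝ) ^ (-k) := by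
  have h1 := Int.abs_sub_lt_one_of_floor_eq_floor h
  have h2 : (0 : ℝ) < 2 ^ k := by positivity
  rw [← mul_sub, abs_mul, abs_of_pos h2] at h1
  rw [zpow_neg, ← one_div, lt_div_iff₀ h2, mul_comm]
  exact h1

/-- The dyadic index of a space-time point: time scale `2^(-k n)`, space scale `2^(-n)`. -/
noncomputable def dyadicIndex {d : ℕ} (k : ℤ → ℤ) (n : ℤ) (z : SpaceTime d) : ℤ × (Fin d → ℤ) :=
  (⌊(2 : ℝ) ^ k n * z.1⌋, fun j => ⌊(2 : ℝ) ^ n * z.2 j⌋)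

theorem dyadicIndex_preimage {d : ℕ} (k : ℤ → ℤ) (n : ℤ) (i : ℤ × (Fin d → ℤ)) :
    dyadicIndex (d := d) k n ⁻¹' {i} = {t : ℝ | ⌊(2 : ℝ) ^ k n * t⌋ = i.1} ×ˢ
      (WithLp.ofLp ⁻¹' (univ.pi fun j => {t : ℝ | ⌊(2 : ℝ) ^ n * t⌋ = i.2 j})) := by
  ext z
  simp [dyadicIndex, Prod.ext_iff, funext_iff]

theorem measurableSet_floor_two_zpow_preimage (k i : ℤ) :
    MeasurableSet {t : ℝ | ⌊(2 : ℝ) ^ k * t⌋ = i} := by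
  rw [floor_two_zpow_preimage]
  exact measurableSet_Ico

theorem measurableSet_dyadicIndex_preimage {d : ℕ} (k : ℤ → ℤ) (n : ℤ) (i : ℤ × (Fin d → ℤ)) :
    MeasurableSet (dyadicIndex (d := d) k n ⁻¹' {i}) := by
  rw [dyadicIndex_preimage]
  refine (measurableSet_floor_two_zpow_preimage _ _).prod ?_
  exact (PiLp.volume_preserving_ofLp (Fin d)).measurable (MeasurableSet.univ_pi fun j =>
    measurableSet_floor_two_zpow_preimage _ _)

theorem volume_dyadicIndex_preimage {d : ℕ} (k : ℤ → ℤ) (n : ℤ) (i : ℤ × (Fin d → ℤ)) :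
    volume (dyadicIndex (d := d) k n ⁻¹' {i})
      = ENNReal.ofReal ((2 : ℝ) ^ (-k n) * ((2 : ℝ) ^ (-n)) ^ d) := by
  rw [dyadicIndex_preimage, Measure.volume_eq_prod, Measure.prod_prod,
    volume_floor_two_zpow_preimage,
    (PiLp.volume_preserving_ofLp (Fin d)).measure_preimage
      (MeasurableSet.univ_pi fun j =>
        measurableSet_floor_two_zpow_preimage _ _).nullMeasurableSet, volume_pi_pi]
  simp_rw [volume_floor_two_zpow_preimage]
  rw [Finset.prod_const, Finset.card_univ, Fintype.card_fin, ENNReal.ofReal_mul (by positivity),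
    ENNReal.ofReal_pow (by positivity)]

theorem dist_lt_of_dyadicIndex_eq {d : ℕ} {k : ℤ → ℤ} {n : ℤ} {z w : SpaceTime d}
    (h : dyadicIndex k n z = dyadicIndex k n w) :
    |z.1 - w.1| < (2 : ℝ) ^ (-k n) ∧ dist z.2 w.2 < (d + 1) * (2 : ℝ) ^ (-n) := by
  obtain ⟨h1, h2⟩ := Prod.ext_iff.1 h
  refine ⟨abs_sub_lt_of_floor_eq h1, ?_⟩
  have h3 : ∀ j, |z.2 j - w.2 j| < (2 : ℝ) ^ (-n) := fun j =>
    abs_sub_lt_of_floor_eq (congrFun h2 j)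
  have hp : (0 : ℝ) < (2 : ℝ) ^ (-n) := by positivity
  rw [EuclideanSpace.dist_eq, Real.sqrt_lt' (by positivity)]
  calc ∑ j, dist (z.2 j) (w.2 j) ^ 2 ≤ ∑ _j : Fin d, ((2 : ℝ) ^ (-n)) ^ 2 := by
        refine Finset.sum_le_sum fun j _ => ?_
        rw [Real.dist_eq]
        have := h3 j
        gcongr
    _ = d * ((2 : ℝ) ^ (-n)) ^ 2 := by simp
    _ < ((d : ℝ) + 1) ^ 2 * ((2 : ℝ) ^ (-n)) ^ 2 := by
        have hd : (0 : ℝ) ≤ d := Nat.cast_nonneg d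
        refine mul_lt_mul_of_pos_right ?_ (by positivity)
        nlinarith
    _ = _ := by ring

theorem volume_cylinder {d : ℕ} (κ : ℝ → ℝ) {δ : ℝ} (hδ : 0 < δ) (z : SpaceTime d) :
    volume (cylinder κ δ z) = ENNReal.ofReal (2 * κ δ) * (ENNReal.ofReal (δ ^ d) *
      volume (Metric.ball (0 : EuclideanSpace ℝ (Fin d)) 1)) := by
  rw [cylinder, Measure.volume_eq_prod, Measure.prod_prod, Real.volume_Ioo,
    Measure.addHaar_ball_of_pos _ _ hδ, finrank_euclideanSpace_fin]
  congr 2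
  ring

/-- Dyadic systems adapted to the parabolic cylinders, with constants depending on `l` only. -/
theorem exists_dyadicSystem (d : ℕ) (l : ℝ → ℝ) {C₀ : ℝ} (hC₀ : 0 < C₀) :
    ∃ N N' : ℝ≥0, ∀ κ : ℝ → ℝ, IsScalingFunction κ → IsScalingFactor κ l →
      ∃ D : DyadicSystem (volume : Measure (SpaceTime d)) (ℤ × (Fin d → ℤ)) N,
        ∀ n z, ∃ δ, 0 < δ ∧ D.cell n z ⊆ cylinder κ δ z ∧
          volume (cylinder κ (C₀ * δ) z) ≤ N' * volume (D.cell n z) := by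
  -- From one generation to the next, space volume changes by `2^d` and time length by at most `2
  -- l(1) l(2)`: `l(2)` for halving the radius, `2 l(1)` for rounding `κ` to a power of two. The
  -- second constant arises in the same way, with `l(C₀)` for the dilation by `C₀`.
  refine ⟨(2 * l 1 * l 2 * 2 ^ d).toNNReal, (4 * l C₀ * l 1 * (C₀ * (d + 1)) ^ d).toNNReal *
    (volume (Metric.ball (0 : EuclideanSpace ℝ (Fin d)) 1)).toNNReal, fun κ hκ hl => ?_⟩
  -- The factor `d + 1` exceeds `√d`, so a cube of side `2^(-n)` lies in the open ball of radius `δ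
  -- n` about any of its points, also when `d = 0`.
  set δ : ℤ → ℝ := fun n => (d + 1) * (2 : ℝ) ^ (-n) with hδdef
  have hδ : ∀ n, 0 < δ n := fun n => by positivity
  have hδle : ∀ n, (2 : ℝ) ^ (-n) ≤ δ n := fun n =>
    le_mul_of_one_le_left (by positivity) (by simp)
  have hanti : Antitone δ := fun m n hmn => by
    refine mul_le_mul_of_nonneg_left ?_ (by positivity)
    exact zpow_le_zpow_right₀ one_le_two (by omega)
  have hl1 : 0 < l 1 := hl.pos hκ one_pos
  have hl2 : 0 < l 2 := hl.pos hκ two_pos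
  have hlC : 0 < l C₀ := hl.pos hκ hC₀
  obtain ⟨k, hk, hk1, hk2⟩ := exists_timeScale hκ hl hδ hanti
  let D : DyadicSystem (volume : Measure (SpaceTime d)) (ℤ × (Fin d → ℤ))
      (2 * l 1 * l 2 * 2 ^ d).toNNReal :=
    { idx := dyadicIndex k
      measurableSet_fiber := measurableSet_dyadicIndex_preimage k
      nested := by
        intro n z w h
        obtain ⟨h1, h2⟩ := Prod.ext_iff.1 h
        refine Prod.ext (floor_two_zpow_mul_eq (hk (by omega)) h1) (funext fun j => ?_)
        exact floor_two_zpow_mul_eq (by omega) (congrFun h2 j)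
      measure_ne_top := by
        intro n z
        rw [volume_dyadicIndex_preimage]
        exact ENNReal.ofReal_ne_top
      doubling := by
        intro n z
        rw [volume_dyadicIndex_preimage, volume_dyadicIndex_preimage, ← ENNReal.ofReal,
          ← ENNReal.ofReal_mul (by positivity)]
        refine ENNReal.ofReal_le_ofReal ?_
        have h1 : δ n = 2 * δ (n + 1) := by
          simp only [hδdef]
          rw [neg_add, zpow_add₀ two_ne_zero, zpow_neg_one]
          ring
        have h2 : (2 : ℝ) ^ (-n) = 2 * 2 ^ (-(n + 1)) := by
          rw [neg_add, zpow_add₀ two_ne_zero, zpow_neg_one]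
          ring
        calc (2 : ℝ) ^ (-k n) * ((2 : ℝ) ^ (-n)) ^ d ≤ κ (δ n) * ((2 : ℝ) ^ (-n)) ^ d := by
              gcongr
              exact hk1 n
          _ ≤ (l 2 * (2 * l 1 * (2 : ℝ) ^ (-k (n + 1)))) * (2 * 2 ^ (-(n + 1))) ^ d := by
              rw [← h2]
              gcongr
              rw [h1]
              refine (hl.scaling 2 _ two_pos (hδ _)).trans ?_
              gcongr
              exact hk2 _
          _ = _ := by
              rw [mul_pow]
              ring
      large := by
        intro z M
        have hev := (hκ.tendsto_atTop.eventually_gt_atTop (2 * l 1 * M))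
        obtain ⟨R, hR⟩ := eventually_atTop.1 hev
        obtain ⟨j, hj⟩ := pow_unbounded_of_one_lt R (one_lt_two : (1 : ℝ) < 2)
        refine ⟨-j, fun n hn => ?_⟩
        rw [volume_dyadicIndex_preimage]
        have h1 : R ≤ δ n := by
          refine hj.le.trans (le_trans ?_ (hδle n))
          rw [← zpow_natCast]
          exact zpow_le_zpow_right₀ one_le_two (by omega)
        have h2 := (hR _ h1).trans_le (hk2 n)
        have h3 : (M : ℝ) < (2 : ℝ) ^ (-k n) := lt_of_mul_lt_mul_left h2 (by positivity)
        have h4 : (1 : ℝ) ≤ (2 : ℝ) ^ (-n) := one_le_zpow₀ one_le_two (by omega)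
        have h5 : (M : ℝ) < (2 : ℝ) ^ (-k n) * ((2 : ℝ) ^ (-n)) ^ d :=
          h3.trans_le (le_mul_of_one_le_right (by positivity) (one_le_pow₀ h4))
        rw [← ENNReal.ofReal_coe_nnreal]
        exact (ENNReal.ofReal_lt_ofReal_iff_of_nonneg M.2).2 h5
      shrinking := by
        intro z U hU
        obtain ⟨ε, hε, hεU⟩ := Metric.mem_nhds_iff.1 hU
        have hev := hκ.tendsto_zero.eventually (gt_mem_nhds hε)
        obtain ⟨η, hη, hη'⟩ := mem_nhdsGT_iff_exists_Ioo_subset.1 hev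
        have hη0 : (0 : ℝ) < η := hη
        have hd : (0 : ℝ) < d + 1 := by positivity
        obtain ⟨j, hj⟩ := exists_pow_lt_of_lt_one (div_pos (lt_min hε hη0) hd)
          (by norm_num : (2 : ℝ)⁻¹ < 1)
        have h1 : δ j < min ε η := by
          simp only [hδdef]
          rw [zpow_neg, zpow_natCast, ← inv_pow, mul_comm]
          exact (lt_div_iff₀ hd).1 hj
        refine ⟨j, fun w hw => hεU ?_⟩
        have h2 := dist_lt_of_dyadicIndex_eq (show dyadicIndex k j w = dyadicIndex k j z from hw)
        rw [Metric.mem_ball, Prod.dist_eq, max_lt_iff]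
        refine ⟨?_, h2.2.trans (h1.trans_le (min_le_left _ _))⟩
        rw [Real.dist_eq]
        exact (h2.1.trans_le (hk1 _)).trans (hη' ⟨hδ _, h1.trans_le (min_le_right _ _)⟩) }
  refine ⟨D, fun n z => ⟨δ n, hδ n, fun w hw => ?_, ?_⟩⟩
  · have h := dist_lt_of_dyadicIndex_eq (show dyadicIndex k n w = dyadicIndex k n z from hw)
    have h1 := abs_lt.1 (h.1.trans_le (hk1 n))
    exact ⟨⟨by linarith [h1.1], by linarith [h1.2]⟩, h.2⟩
  · have hcell : volume (D.cell n z)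
        = ENNReal.ofReal ((2 : ℝ) ^ (-k n) * ((2 : ℝ) ^ (-n)) ^ d) :=
      volume_dyadicIndex_preimage k n _
    have hpos := hδ n
    rw [hcell, volume_cylinder κ (mul_pos hC₀ (hδ n)), ← mul_assoc,
      ENNReal.coe_mul, ENNReal.coe_toNNReal measure_ball_lt_top.ne,
      mul_right_comm ((Real.toNNReal _ : ℝ≥0) : ℝ≥0∞)]
    refine mul_le_mul' ?_ le_rfl
    rw [← ENNReal.ofReal, 
      ← ENNReal.ofReal_mul (p := 4 * l C₀ * l 1 * (C₀ * (d + 1)) ^ d) (by positivity),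
      ← ENNReal.ofReal_mul' (p := 2 * κ (C₀ * δ n)) (by positivity)]
    refine ENNReal.ofReal_le_ofReal ?_
    calc 2 * κ (C₀ * δ n) * (C₀ * δ n) ^ d
        ≤ 2 * (l C₀ * (2 * l 1 * (2 : ℝ) ^ (-k n))) * (C₀ * δ n) ^ d := by
          gcongr
          refine (hl.scaling C₀ _ hC₀ (hδ n)).trans ?_
          gcongr
          exact hk2 n
      _ = _ := by
          simp only [hδdef]
          rw [← mul_assoc C₀, mul_pow (C₀ * (d + 1))]
          ring

end Dyadic

/-! ### Integrability of the kernel and the `L²` bound beyond smooth functions. -/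

section Kernel

open scoped Convolution

set_option linter.unusedSectionVars false

variable {d : ℕ} {V : Type*} [NormedAddCommGroup V] [InnerProductSpace ℝ V]
  [CompleteSpace V]

/-- `f` is strongly measurable and bounded, and vanishes outside a bounded set. -/
structure IsBddCompactSupp (f : SpaceTime d → V) : Prop where
  stronglyMeasurable : StronglyMeasurable f
  bdd : ∃ C : ℝ, ∀ z, ‖f z‖ ≤ C
  eq_zero : ∃ R : ℝ, ∀ z, R < ‖z‖ → f z = 0

theorem IsTestFunction.isBddCompactSupp {f : SpaceTime d → V} (hf : IsTestFunction f) :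
    IsBddCompactSupp f := by
  refine ⟨hf.1.continuous.stronglyMeasurable, ?_, ?_⟩
  · obtain ⟨C, hC⟩ := hf.2.exists_bound_of_continuous hf.1.continuous
    exact ⟨C, hC⟩
  · obtain ⟨R, hR⟩ := hf.2.isCompact.isBounded.subset_closedBall 0
    refine ⟨R, fun z hz => ?_⟩
    by_contra h
    have := hR (subset_tsupport f h)
    rw [mem_closedBall_zero_iff] at this
    linarith

namespace IsBddCompactSupp

variable {f g : SpaceTime d → V}

theorem sub (hf : IsBddCompactSupp f) (hg : IsBddCompactSupp g) :
    IsBddCompactSupp (f - g) := by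
  obtain ⟨C, hC⟩ := hf.bdd
  obtain ⟨C', hC'⟩ := hg.bdd
  obtain ⟨R, hR⟩ := hf.eq_zero
  obtain ⟨R', hR'⟩ := hg.eq_zero
  refine ⟨hf.stronglyMeasurable.sub hg.stronglyMeasurable, ⟨C + C', fun z => ?_⟩,
    ⟨max R R', fun z hz => ?_⟩⟩
  · exact (norm_sub_le _ _).trans (add_le_add (hC z) (hC' z))
  · rw [max_lt_iff] at hz
    simp [hR z hz.1, hR' z hz.2]

theorem indicator (hf : IsBddCompactSupp f) {s : Set (SpaceTime d)} (hs : MeasurableSet s) :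
    IsBddCompactSupp (s.indicator f) := by
  obtain ⟨C, hC⟩ := hf.bdd
  obtain ⟨R, hR⟩ := hf.eq_zero
  refine ⟨hf.stronglyMeasurable.indicator hs, ⟨C, fun z => ?_⟩, ⟨R, fun z hz => ?_⟩⟩
  · exact (norm_indicator_le_norm_self _ _).trans (hC z)
  · exact indicator_apply_eq_zero.2 fun _ => hR z hz

theorem memLp (hf : IsBddCompactSupp f) (p : ℝ≥0∞) : MemLp f p volume := by
  obtain ⟨C, hC⟩ := hf.bdd
  obtain ⟨R, hR⟩ := hf.eq_zero
  have h : (Metric.closedBall (0 : SpaceTime d) R).indicator f = f := by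
    refine indicator_eq_self.2 fun z hz => ?_
    rw [mem_closedBall_zero_iff]
    by_contra h
    exact hz (hR z (not_le.1 h))
  rw [← h, memLp_indicator_iff_restrict measurableSet_closedBall]
  have : IsFiniteMeasure (volume.restrict (Metric.closedBall (0 : SpaceTime d) R)) :=
    isFiniteMeasure_restrict.2 measure_closedBall_lt_top.ne
  exact MemLp.of_bound hf.stronglyMeasurable.aestronglyMeasurable C (Eventually.of_forall hC)

/-- Mollification with uniform bounds. -/
theorem exists_testFunction_tendsto (hf : IsBddCompactSupp f) :
    ∃ φ : ℕ → SpaceTime d → V, (∀ n, IsTestFunction (φ n)) ∧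
      ∃ C R : ℝ, (∀ n z, ‖φ n z‖ ≤ C) ∧ (∀ n z, R < ‖z‖ → φ n z = 0) ∧
        ∀ᵐ z, Tendsto (fun n => φ n z) atTop (𝓝 (f z)) := by
  obtain ⟨C, hC⟩ := hf.bdd
  obtain ⟨R, hR⟩ := hf.eq_zero
  -- The ratio of outer to inner radius stays equal to `2`, as needed for convergence almost
  -- everywhere of the mollifications of a merely locally integrable function.
  let b : ℕ → ContDiffBump (0 : SpaceTime d) := fun n =>
    ⟨1 / (2 * ((n : ℝ) + 1)), 1 / ((n : ℝ) + 1), by positivity, by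
      refine one_div_lt_one_div_of_lt (by positivity) ?_
      have : (0 : ℝ) ≤ n := Nat.cast_nonneg n
      linarith⟩
  have hHaar : (volume : Measure (SpaceTime d)).IsAddHaarMeasure :=
    inferInstanceAs (Measure.prod volume volume).IsAddHaarMeasure
  have hloc : LocallyIntegrable f volume :=
    ((memLp_one_iff_integrable).1 (hf.memLp 1)).locallyIntegrable
  have hzero : ∀ n z, R + 1 < ‖z‖ →
      ((b n).normed volume ⋆[ContinuousLinearMap.lsmul ℝ ℝ, volume] f) z = 0 := by
    intro n z hz
    have hb : (b n).rOut ≤ 1 := by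
      change 1 / ((n : ℝ) + 1) ≤ 1
      rw [div_le_one (by positivity)]
      simp
    have h0 : ∀ x ∈ Metric.ball z (b n).rOut, f x = 0 := by
      intro x hx
      refine hR x ?_
      have h1 := Metric.mem_ball.1 hx
      rw [dist_comm, dist_eq_norm] at h1
      have h2 := norm_sub_norm_le z x
      linarith
    have hz0 := h0 z (Metric.mem_ball_self (b n).rOut_pos)
    rw [(b n).normed_convolution_eq_right fun x hx => (h0 x hx).trans hz0.symm, hz0]
  refine ⟨fun n => (b n).normed volume ⋆[ContinuousLinearMap.lsmul ℝ ℝ, volume] f,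
    fun n => ⟨?_, ?_⟩, 3 * C, R + 1, fun n z => ?_, hzero, ?_⟩
  · exact (b n).hasCompactSupport_normed.contDiff_convolution_left _ (b n).contDiff_normed hloc
  · refine HasCompactSupport.intro (isCompact_closedBall (0 : SpaceTime d) (R + 1)) fun z hz => ?_
    exact hzero n z (by simpa only [mem_closedBall_zero_iff, not_le] using hz)
  · have h1 : dist (((b n).normed volume ⋆[ContinuousLinearMap.lsmul ℝ ℝ, volume] f) z) (f z)
        ≤ 2 * C := by
      refine (b n).dist_normed_convolution_le hf.stronglyMeasurable.aestronglyMeasurable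
        fun x _ => ?_
      rw [dist_eq_norm]
      linarith [norm_sub_le (f x) (f z), hC x, hC z]
    rw [dist_eq_norm] at h1
    have h2 := norm_le_norm_add_norm_sub'
      (((b n).normed volume ⋆[ContinuousLinearMap.lsmul ℝ ℝ, volume] f) z) (f z)
    linarith [hC z]
  · refine ContDiffBump.ae_convolution_tendsto_right_of_locallyIntegrable (K := 2)
      tendsto_one_div_add_atTop_nhds_zero_nat (Eventually.of_forall fun n => ?_) hloc
    change 1 / ((n : ℝ) + 1) ≤ 2 * (1 / (2 * ((n : ℝ) + 1)))
    exact le_of_eq (by field_simp)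

end IsBddCompactSupp

variable {K : SpaceTime d → SpaceTime d → ℝ}

/-- Test the hypothesis with a bump function equal to `1` on the ball, times a fixed nonzero vector.
The null set does not depend on the ball, because the exceptional set in `hKi` is independent of the
test function. -/
theorem ae_integrableOn_closedBall [Nontrivial V] (hK : Measurable (Function.uncurry K))
    (hKi : ∀ᵐ z, ∀ f : SpaceTime d → V, IsTestFunction f →
      Integrable (fun w => K z w • f w) volume) :
    ∀ᵐ z, ∀ R : ℝ, IntegrableOn (K z) (Metric.closedBall 0 R) := by
  obtain ⟨v, hv⟩ := exists_ne (0 : V)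
  filter_upwards [hKi] with z hz R
  let ψ : ContDiffBump (0 : SpaceTime d) := ⟨|R| + 1, |R| + 2, by positivity, by linarith⟩
  have h1 : IsTestFunction (fun w => ψ w • v) := by
    refine ⟨ψ.contDiff.smul contDiff_const, ?_⟩
    exact ψ.hasCompactSupport.smul_right
  have h2 := (hz _ h1).norm.const_mul ‖v‖⁻¹
  have hKz : Measurable (K z) := hK.comp measurable_prodMk_left
  refine Integrable.mono' h2.integrableOn hKz.aestronglyMeasurable ?_
  filter_upwards [ae_restrict_mem measurableSet_closedBall] with w hw
  have : ψ w = 1 := by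
    refine ψ.one_of_mem_closedBall (Metric.closedBall_subset_closedBall ?_ hw)
    change R ≤ |R| + 1
    linarith [le_abs_self R]
  have hv' : ‖v‖ ≠ 0 := norm_ne_zero_iff.2 hv
  rw [this, one_smul, norm_smul]
  exact le_of_eq (by field_simp)

theorem ae_integrable_smul (hK : Measurable (Function.uncurry K))
    (hKi : ∀ᵐ z, ∀ f : SpaceTime d → V, IsTestFunction f →
      Integrable (fun w => K z w • f w) volume) :
    ∀ᵐ z, ∀ f : SpaceTime d → V, IsBddCompactSupp f →
      Integrable (fun w => K z w • f w) volume := by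
  rcases subsingleton_or_nontrivial V with hV | hV
  · refine Eventually.of_forall fun z f _ => ?_
    have : (fun w => K z w • f w) = 0 := funext fun w => Subsingleton.elim _ _
    rw [this]
    exact integrable_zero _ _ _
  filter_upwards [ae_integrableOn_closedBall hK hKi] with z hz f hf
  obtain ⟨C, hC⟩ := hf.bdd
  obtain ⟨R, hR⟩ := hf.eq_zero
  have hKz : Measurable (K z) := hK.comp measurable_prodMk_left
  have h : IntegrableOn (fun w => K z w • f w) (Metric.closedBall 0 R) :=
    (hz R).smul_bdd C hf.stronglyMeasurable.aestronglyMeasurable (Eventually.of_forall hC)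
  refine h.integrable_of_forall_notMem_eq_zero fun w hw => ?_
  rw [hR w (by simpa using hw), smul_zero]

theorem stronglyMeasurable_kernelTransform (hK : Measurable (Function.uncurry K))
    {f : SpaceTime d → V} (hf : StronglyMeasurable f) :
    StronglyMeasurable (Function.uncurry (kernelTransform K f)) := by
  have h : StronglyMeasurable (fun q : (SpaceTime d × ℝ) × EuclideanSpace ℝ (Fin d) =>
      K q.1.1 (q.1.2, q.2) • f (q.1.2, q.2)) := by
    refine StronglyMeasurable.smul ?_ ?_
    · refine Measurable.stronglyMeasurable ?_
      exact hK.comp (f := fun q : (SpaceTime d × ℝ) × EuclideanSpace ℝ (Fin d) =>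
        (q.1.1, ((q.1.2, q.2) : SpaceTime d))) (by fun_prop)
    · exact hf.comp_measurable (by fun_prop)
  exact h.integral_prod_right'

/-- `∫ |F(t,x,s)|² ds`. -/
noncomputable def squareIntegral (F : SpaceTime d → ℝ → V) (z : SpaceTime d) : ℝ≥0∞ :=
  ∫⁻ s, ‖F z s‖ₑ ^ 2

theorem measurable_squareIntegral {F : SpaceTime d → ℝ → V}
    (hF : StronglyMeasurable (Function.uncurry F)) : Measurable (squareIntegral F) := by
  have : Measurable fun q : SpaceTime d × ℝ => ‖F q.1 q.2‖ₑ ^ 2 := hF.enorm.pow_const 2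
  exact this.lintegral_prod_right'

theorem eLpNorm_squareFunction (F : SpaceTime d → ℝ → V) {p : ℝ} (hp : 0 < p) :
    eLpNorm (squareFunction F) (ENNReal.ofReal p) volume
      = (∫⁻ z, squareIntegral F z ^ (p / 2)) ^ (1 / p) := by
  rw [eLpNorm_eq_lintegral_rpow_enorm_toReal (by simpa using hp) ENNReal.ofReal_ne_top,
    ENNReal.toReal_ofReal hp.le]
  congr 1
  refine lintegral_congr fun z => ?_
  rw [enorm_eq_self, squareFunction, ← ENNReal.rpow_mul, squareIntegral]
  congr 1
  ring

theorem eLpNorm_squareFunction_two (F : SpaceTime d → ℝ → V) :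
    eLpNorm (squareFunction F) 2 volume = (∫⁻ z, squareIntegral F z) ^ (1 / 2 : ℝ) := by
  have := eLpNorm_squareFunction F two_pos
  simpa using this

theorem eLpNorm_two_eq (f : SpaceTime d → V) :
    eLpNorm f 2 volume = (∫⁻ z, ‖f z‖ₑ ^ 2) ^ (1 / 2 : ℝ) := by
  rw [eLpNorm_eq_lintegral_rpow_enorm_toReal (by simp) (by simp)]
  simp

theorem eLpNorm_squareFunction_two_le_iff (F : SpaceTime d → ℝ → V)
    (f : SpaceTime d → V) (M : ℝ≥0) :
    eLpNorm (squareFunction F) 2 volume ≤ M * eLpNorm f 2 volume ↔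
      ∫⁻ z, squareIntegral F z ≤ M ^ 2 * ∫⁻ z, ‖f z‖ₑ ^ 2 := by
  rw [eLpNorm_squareFunction_two, eLpNorm_two_eq]
  have : (M : ℝ≥0∞) = ((M : ℝ≥0∞) ^ 2) ^ (1 / 2 : ℝ) := by
    rw [← ENNReal.rpow_natCast_mul]
    simp
  rw [this, ← ENNReal.mul_rpow_of_nonneg _ _ (by positivity),
    ENNReal.rpow_le_rpow_iff (by positivity), ← this]

/-- The `L²` bound extends from test functions to bounded functions of bounded support. -/
theorem lintegral_squareIntegral_kernelTransform_le (hK : Measurable (Function.uncurry K))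
    (hKi : ∀ᵐ z, ∀ f : SpaceTime d → V, IsTestFunction f →
      Integrable (fun w => K z w • f w) volume) {M₀ : ℝ≥0}
    (hM : ∀ f : SpaceTime d → V, IsTestFunction f →
        eLpNorm (stochOperator K f) 2 volume ≤ M₀ * eLpNorm f 2 volume)
    {f : SpaceTime d → V} (hf : IsBddCompactSupp f) :
    ∫⁻ z, squareIntegral (kernelTransform K f) z ≤ M₀ ^ 2 * ∫⁻ z, ‖f z‖ₑ ^ 2 := by
  have hM' : ∀ f : SpaceTime d → V, IsTestFunction f →
      ∫⁻ z, squareIntegral (kernelTransform K f) z ≤ M₀ ^ 2 * ∫⁻ z, ‖f z‖ₑ ^ 2 := fun f hf =>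
    (eLpNorm_squareFunction_two_le_iff _ _ _).1 (hM f hf)
  rcases subsingleton_or_nontrivial V with hV | hV
  · have h0 : f = fun _ => 0 := funext fun w => Subsingleton.elim _ _
    refine hM' f ?_
    rw [h0]
    exact ⟨contDiff_const, HasCompactSupport.zero⟩
  obtain ⟨φ, hφ, C, R, hC, hR, hlim⟩ := hf.exists_testFunction_tendsto
  have hlim2 : ∀ᵐ s : ℝ, ∀ᵐ y, Tendsto (fun n => φ n (s, y)) atTop (𝓝 (f (s, y))) :=
    Measure.ae_ae_of_ae_prod hlim
  -- The mollifications share one bound and one bounded support, so local integrability of `K z`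
  -- allows dominated convergence in `y` for almost every `s`. Fatou's lemma in `s` follows, and a
  -- second application in `z` concludes.
  have hpt : ∀ᵐ z, squareIntegral (kernelTransform K f) z
      ≤ liminf (fun n => squareIntegral (kernelTransform K (φ n)) z) atTop := by
    filter_upwards [ae_integrableOn_closedBall hK hKi] with z hz
    have hKz : Measurable (K z) := hK.comp measurable_prodMk_left
    have h1 : Integrable (fun w => C * ‖(Metric.closedBall 0 R).indicator (K z) w‖) :=
      (((hz R).integrable_indicator measurableSet_closedBall).norm).const_mul C
    have hconv : ∀ᵐ s, Tendsto (fun n => kernelTransform K (φ n) z s) atTop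
        (𝓝 (kernelTransform K f z s)) := by
      filter_upwards [hlim2, h1.prod_right_ae] with s hs hs1
      refine tendsto_integral_of_dominated_convergence _ (fun n => ?_) hs1
        (fun n => Eventually.of_forall fun y => ?_) ?_
      · refine AEStronglyMeasurable.smul ?_ ?_
        · exact (hKz.comp measurable_prodMk_left).aestronglyMeasurable
        · exact ((hφ n).isBddCompactSupp.stronglyMeasurable.comp_measurable
            measurable_prodMk_left).aestronglyMeasurable
      · by_cases hy : ((s, y) : SpaceTime d) ∈ Metric.closedBall (0 : SpaceTime d) R
        · rw [indicator_of_mem hy, norm_smul, mul_comm]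
          gcongr
          exact hC n _
        · rw [hR n _ (by simpa only [mem_closedBall_zero_iff, not_le] using hy), smul_zero,
            norm_zero, indicator_of_notMem hy, norm_zero, mul_zero]
      · filter_upwards [hs] with y hy
        exact hy.const_smul _
    calc squareIntegral (kernelTransform K f) z
        ≤ ∫⁻ s, liminf (fun n => ‖kernelTransform K (φ n) z s‖ₑ ^ 2) atTop := by
          refine lintegral_mono_ae ?_
          filter_upwards [hconv] with s hs
          refine le_of_eq (Tendsto.liminf_eq ?_).symm
          exact (ENNReal.continuous_pow 2).continuousAt.tendsto.comp hs.enorm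
      _ ≤ _ := lintegral_liminf_le fun n =>
          ((stronglyMeasurable_kernelTransform hK
            (hφ n).isBddCompactSupp.stronglyMeasurable).comp_measurable
              measurable_prodMk_left).enorm.pow_const 2
  have hnorm : Tendsto (fun n => ∫⁻ z, ‖φ n z‖ₑ ^ 2) atTop (𝓝 (∫⁻ z, ‖f z‖ₑ ^ 2)) := by
    refine tendsto_lintegral_of_dominated_convergence
      ((Metric.closedBall 0 R).indicator fun _ => ENNReal.ofReal C ^ 2)
      (fun n => (hφ n).isBddCompactSupp.stronglyMeasurable.enorm.pow_const 2)
      (fun n => Eventually.of_forall fun z => ?_) ?_ ?_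
    · by_cases hz : z ∈ Metric.closedBall (0 : SpaceTime d) R
      · change ‖φ n z‖ₑ ^ 2 ≤ _
        rw [indicator_of_mem hz, ← ofReal_norm]
        gcongr
        exact hC n z
      · simp [hR n z (by simpa only [mem_closedBall_zero_iff, not_le] using hz)]
    · rw [lintegral_indicator measurableSet_closedBall, setLIntegral_const]
      exact ENNReal.mul_ne_top (by finiteness) measure_closedBall_lt_top.ne
    · filter_upwards [hlim] with z hz
      exact (ENNReal.continuous_pow 2).continuousAt.tendsto.comp hz.enorm
  calc ∫⁻ z, squareIntegral (kernelTransform K f) z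
      ≤ ∫⁻ z, liminf (fun n => squareIntegral (kernelTransform K (φ n)) z) atTop :=
        lintegral_mono_ae hpt
    _ ≤ liminf (fun n => ∫⁻ z, squareIntegral (kernelTransform K (φ n)) z) atTop :=
        lintegral_liminf_le fun n => measurable_squareIntegral
          (stronglyMeasurable_kernelTransform hK (hφ n).isBddCompactSupp.stronglyMeasurable)
    _ ≤ liminf (fun n => M₀ ^ 2 * ∫⁻ z, ‖φ n z‖ₑ ^ 2) atTop :=
        liminf_le_liminf (Eventually.of_forall fun n => hM' _ (hφ n))
    _ = M₀ ^ 2 * ∫⁻ z, ‖f z‖ₑ ^ 2 :=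
        (ENNReal.Tendsto.const_mul hnorm (Or.inr (by finiteness))).liminf_eq

end Kernel

/-! ### The Hörmander condition on one cell and the estimate for bounded `f`. -/

theorem ennreal_add_sq_le (a b : ℝ≥0∞) : (a + b) ^ 2 ≤ 2 * a ^ 2 + 2 * b ^ 2 := by
  rcases eq_or_ne a ⊤ with rfl | ha
  · simp
  rcases eq_or_ne b ⊤ with rfl | hb
  · simp
  lift a to ℝ≥0 using ha
  lift b to ℝ≥0 using hb
  have := add_sq_le (a := a) (b := b)
  rw [mul_add] at this
  exact_mod_cast this

theorem enorm_sub_sq_le {V : Type*} [NormedAddCommGroup V] (a b : V) :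
    ‖a - b‖ₑ ^ 2 ≤ 2 * ‖a‖ₑ ^ 2 + 2 * ‖b‖ₑ ^ 2 :=
  (pow_le_pow_left₀ zero_le enorm_sub_le 2).trans (ennreal_add_sq_le _ _)

section CellEstimate

set_option linter.unusedSectionVars false

variable {d : ℕ} {V : Type*} [NormedAddCommGroup V] [InnerProductSpace ℝ V] [CompleteSpace V]
  {K : SpaceTime d → SpaceTime d → ℝ} {f g : SpaceTime d → V}

theorem squareIntegral_sub_le {F G : SpaceTime d → ℝ → V}
    (hF : StronglyMeasurable (Function.uncurry F)) (z : SpaceTime d) :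
    squareIntegral (F - G) z ≤ 2 * squareIntegral F z + 2 * squareIntegral G z := by
  have hFz : Measurable fun s => ‖F z s‖ₑ ^ 2 :=
    (hF.comp_measurable measurable_prodMk_left).enorm.pow_const 2
  calc squareIntegral (F - G) z ≤ ∫⁻ s, (2 * ‖F z s‖ₑ ^ 2 + 2 * ‖G z s‖ₑ ^ 2) :=
        lintegral_mono fun s => enorm_sub_sq_le _ _
    _ = _ := by
        rw [lintegral_add_left (hFz.const_mul 2), lintegral_const_mul _ hFz,
          lintegral_const_mul' _ _ (by simp)]
        rfl

/-- The points `z` for which `K z • f` is integrable for all bounded `f` of bounded support. -/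
def IsRegularPoint (V : Type*) [NormedAddCommGroup V] [InnerProductSpace ℝ V]
    (K : SpaceTime d → SpaceTime d → ℝ) (z : SpaceTime d) : Prop :=
  ∀ f : SpaceTime d → V, IsBddCompactSupp f → Integrable (fun w => K z w • f w) volume

theorem IsRegularPoint.ae_integrable {z : SpaceTime d} (hz : IsRegularPoint V K z)
    (hf : IsBddCompactSupp f) : ∀ᵐ s, Integrable (fun y => K z (s, y) • f (s, y)) volume :=
  (hz f hf).prod_right_ae

theorem IsRegularPoint.kernelTransform_sub {z : SpaceTime d} (hz : IsRegularPoint V K z)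
    (hf : IsBddCompactSupp f) (hg : IsBddCompactSupp g) :
    ∀ᵐ s, kernelTransform K (f - g) z s = kernelTransform K f z s - kernelTransform K g z s := by
  filter_upwards [hz.ae_integrable hf, hz.ae_integrable hg] with s h1 h2
  rw [kernelTransform, kernelTransform, kernelTransform, ← integral_sub h1 h2]
  exact integral_congr_ae (Eventually.of_forall fun y => smul_sub _ _ _)

theorem IsRegularPoint.squareIntegral_sub_eq {z : SpaceTime d} (hz : IsRegularPoint V K z)
    (hf : IsBddCompactSupp f) (hg : IsBddCompactSupp g) :
    squareIntegral (kernelTransform K (f - g)) z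
      = squareIntegral (kernelTransform K f - kernelTransform K g) z := by
  refine lintegral_congr_ae ?_
  filter_upwards [hz.kernelTransform_sub hf hg] with s hs
  simp only [hs, Pi.sub_apply]

theorem IsRegularPoint.squareIntegral_sub_le {z : SpaceTime d} (hz : IsRegularPoint V K z)
    (hK : Measurable (Function.uncurry K)) (hf : IsBddCompactSupp f) (hg : IsBddCompactSupp g) :
    squareIntegral (kernelTransform K (f - g)) z
      ≤ 2 * squareIntegral (kernelTransform K f) z + 2 * squareIntegral (kernelTransform K g) z := by
  rw [hz.squareIntegral_sub_eq hf hg]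
  exact StochHormander.squareIntegral_sub_le
    (stronglyMeasurable_kernelTransform hK hf.stronglyMeasurable) z

theorem IsRegularPoint.squareIntegral_le {z : SpaceTime d} (hz : IsRegularPoint V K z)
    (hK : Measurable (Function.uncurry K)) (hf : IsBddCompactSupp f) (hg : IsBddCompactSupp g) :
    squareIntegral (kernelTransform K f) z
      ≤ 2 * squareIntegral (kernelTransform K (f - g)) z
        + 2 * squareIntegral (kernelTransform K g) z := by
  -- `g - g - g` is `-g`, written so that the bound for differences and the closure of the class
  -- under subtraction apply.
  have h1 : f = (f - g) - (g - g - g) := by simp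
  have h2 := hz.squareIntegral_sub_le hK (hf.sub hg) ((hg.sub hg).sub hg)
  rw [← h1] at h2
  refine h2.trans (add_le_add_right (mul_le_mul_right (le_of_eq ?_) _) _)
  refine lintegral_congr fun s => ?_
  have h3 : kernelTransform K (g - g - g) z s = -kernelTransform K g z s := by
    simp only [kernelTransform, ← integral_neg]
    exact integral_congr_ae (Eventually.of_forall fun y => by simp)
  rw [h3, enorm_neg]

/-- The Hörmander condition compares a point only with the centre `z₀`. Passing through `K z₀` uses
it twice, and squaring the sum gives the factor `4`. -/
theorem IsRegularPoint.lintegral_enorm_sub_sq_le {κ : ℝ → ℝ} {C₀ : ℝ} {M₁ : ℝ≥0}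
    (hK : Measurable (Function.uncurry K)) (hH : HormanderCondition κ C₀ M₁ K)
    {δ : ℝ} (hδ : 0 < δ) {z₀ z z' : SpaceTime d} (hz : IsRegularPoint V K z)
    (hz' : IsRegularPoint V K z') (hzc : z ∈ cylinder κ δ z₀) (hzc' : z' ∈ cylinder κ δ z₀)
    (hg : IsBddCompactSupp g) {r : ℝ≥0} (hr : ∀ w, ‖g w‖ₑ ≤ r)
    (hg0 : ∀ w ∈ cylinder κ (C₀ * δ) z₀, g w = 0) :
    ∫⁻ s, ‖kernelTransform K g z s - kernelTransform K g z' s‖ₑ ^ 2 ≤ 4 * r ^ 2 * M₁ := by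
  have hKm : ∀ u, Measurable (K u) := fun u => hK.comp measurable_prodMk_left
  have hcyl : MeasurableSet (cylinder κ (C₀ * δ) z₀) :=
    measurableSet_Ioo.prod measurableSet_ball
  set H : SpaceTime d → SpaceTime d → ℝ≥0∞ := fun u =>
    (cylinder κ (C₀ * δ) z₀)ᶜ.indicator (fun w => ‖K z₀ w - K u w‖ₑ) with hHdef
  have hHm : ∀ u, Measurable (H u) := fun u =>
    ((hKm z₀).sub (hKm u)).enorm.indicator hcyl.compl
  have hHm' : ∀ u, Measurable fun s => ∫⁻ y, H u (s, y) := fun u => (hHm u).lintegral_prod_right'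
  have hpt : ∀ᵐ s, ‖kernelTransform K g z s - kernelTransform K g z' s‖ₑ ^ 2
      ≤ 2 * r ^ 2 * (∫⁻ y, H z (s, y)) ^ 2 + 2 * r ^ 2 * (∫⁻ y, H z' (s, y)) ^ 2 := by
    filter_upwards [hz.ae_integrable hg, hz'.ae_integrable hg] with s h1 h2
    have h3 : ‖kernelTransform K g z s - kernelTransform K g z' s‖ₑ
        ≤ r * (∫⁻ y, H z (s, y)) + r * (∫⁻ y, H z' (s, y)) := by
      rw [kernelTransform, kernelTransform, ← integral_sub h1 h2]
      refine (enorm_integral_le_lintegral_enorm _).trans ?_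
      have m1 : Measurable fun y => (r : ℝ≥0∞) * H z (s, y) :=
        ((hHm z).comp measurable_prodMk_left).const_mul _
      rw [← lintegral_const_mul' _ _ ENNReal.coe_ne_top,
        ← lintegral_const_mul' _ _ ENNReal.coe_ne_top, ← lintegral_add_left m1]
      refine lintegral_mono fun y => ?_
      simp only [hHdef]
      by_cases hy : ((s, y) : SpaceTime d) ∈ cylinder κ (C₀ * δ) z₀
      · simp [hg0 _ hy]
      · rw [indicator_of_mem (show _ ∈ (cylinder κ (C₀ * δ) z₀)ᶜ from hy),
          indicator_of_mem (show _ ∈ (cylinder κ (C₀ * δ) z₀)ᶜ from hy), ← sub_smul, enorm_smul,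
          ← mul_add, mul_comm]
        refine mul_le_mul' (hr _) ?_
        have h4 : K z (s, y) - K z' (s, y)
            = (K z₀ (s, y) - K z' (s, y)) - (K z₀ (s, y) - K z (s, y)) := by ring
        rw [h4, add_comm]
        exact enorm_sub_le
    calc _ ≤ (r * (∫⁻ y, H z (s, y)) + r * (∫⁻ y, H z' (s, y))) ^ 2 := by gcongr
      _ ≤ _ := ennreal_add_sq_le _ _
      _ = _ := by ring
  refine (lintegral_mono_ae hpt).trans ?_
  rw [lintegral_add_left (((hHm' z).pow_const 2).const_mul _),
    lintegral_const_mul _ ((hHm' z).pow_const 2), lintegral_const_mul _ ((hHm' z').pow_const 2)]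
  calc _ ≤ 2 * (r : ℝ≥0∞) ^ 2 * M₁ + 2 * r ^ 2 * M₁ := by
        gcongr
        · exact hH z₀ δ hδ z hzc
        · exact hH z₀ δ hδ z' hzc'
    _ = _ := by ring

/-- The far part `h - h₁` is moved from `z` to `z'` by the Hörmander condition. At `z'` it is
rewritten as `f - (f - h) - h₁`, so that `f` itself reappears and can later be averaged over `z'`.
Each splitting costs a factor `2`, whence the powers of two. -/
theorem IsRegularPoint.squareIntegral_le_of_mem_cylinder {κ : ℝ → ℝ} {C₀ : ℝ} {M₁ : ℝ≥0}
    (hK : Measurable (Function.uncurry K)) (hH : HormanderCondition κ C₀ M₁ K)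
    {δ : ℝ} (hδ : 0 < δ) {z₀ z z' : SpaceTime d} (hz : IsRegularPoint V K z)
    (hz' : IsRegularPoint V K z') (hzc : z ∈ cylinder κ δ z₀) (hzc' : z' ∈ cylinder κ δ z₀)
    {h h₁ : SpaceTime d → V}
    (hf : IsBddCompactSupp f) (hh : IsBddCompactSupp h) (hh₁ : IsBddCompactSupp h₁)
    {r : ℝ≥0} (hr : ∀ w, ‖(h - h₁) w‖ₑ ≤ r)
    (h0 : ∀ w ∈ cylinder κ (C₀ * δ) z₀, (h - h₁) w = 0) :
    squareIntegral (kernelTransform K f) z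
      ≤ 2 * squareIntegral (kernelTransform K (f - h)) z
        + 4 * squareIntegral (kernelTransform K h₁) z + 32 * r ^ 2 * M₁
        + (32 * squareIntegral (kernelTransform K f) z'
          + 32 * squareIntegral (kernelTransform K (f - h)) z'
          + 16 * squareIntegral (kernelTransform K h₁) z') := by
  have e1 := hz.squareIntegral_le hK hf hh
  have e2 := hz.squareIntegral_le hK hh hh₁
  have e3 : squareIntegral (kernelTransform K (h - h₁)) z
      ≤ 2 * (4 * r ^ 2 * M₁) + 2 * squareIntegral (kernelTransform K (h - h₁)) z' := by
    have hm : StronglyMeasurable (Function.uncurry (kernelTransform K (h - h₁))) :=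
      stronglyMeasurable_kernelTransform hK (hh.sub hh₁).stronglyMeasurable
    have m1 : Measurable fun s => 2 * ‖kernelTransform K (h - h₁) z s
        - kernelTransform K (h - h₁) z' s‖ₑ ^ 2 :=
      (((hm.comp_measurable measurable_prodMk_left).sub
        (hm.comp_measurable measurable_prodMk_left)).enorm.pow_const 2).const_mul 2
    calc squareIntegral (kernelTransform K (h - h₁)) z
        ≤ ∫⁻ s, (2 * ‖kernelTransform K (h - h₁) z s - kernelTransform K (h - h₁) z' s‖ₑ ^ 2
          + 2 * ‖kernelTransform K (h - h₁) z' s‖ₑ ^ 2) := by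
          refine lintegral_mono fun s => ?_
          refine le_trans (le_of_eq ?_) ((pow_le_pow_left₀ zero_le
            (enorm_add_le (kernelTransform K (h - h₁) z s - kernelTransform K (h - h₁) z' s)
              (kernelTransform K (h - h₁) z' s)) 2).trans (ennreal_add_sq_le _ _))
          rw [sub_add_cancel]
      _ ≤ _ := by
          rw [lintegral_add_left m1, lintegral_const_mul' _ _ (by simp),
            lintegral_const_mul' _ _ (by simp)]
          gcongr
          · exact IsRegularPoint.lintegral_enorm_sub_sq_le hK hH hδ hz hz' hzc hzc'
              (hh.sub hh₁) hr h0
          · exact le_rfl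
  have e4 := hz'.squareIntegral_sub_le hK hh hh₁
  have e5 := hz'.squareIntegral_sub_le hK hf (hf.sub hh)
  rw [sub_sub_cancel] at e5
  calc squareIntegral (kernelTransform K f) z
      ≤ 2 * squareIntegral (kernelTransform K (f - h)) z
        + 2 * (2 * (2 * (4 * r ^ 2 * M₁) + 2 * (2 * (2 * squareIntegral (kernelTransform K f) z'
          + 2 * squareIntegral (kernelTransform K (f - h)) z')
          + 2 * squareIntegral (kernelTransform K h₁) z'))
          + 2 * squareIntegral (kernelTransform K h₁) z) := by
        refine e1.trans ?_
        gcongr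
        refine e2.trans ?_
        gcongr
        refine e3.trans ?_
        gcongr
        refine e4.trans ?_
        gcongr
    _ = _ := by ring

/-- The excess estimate on one cell. -/
theorem setLIntegral_squareIntegral_tsub_le {κ : ℝ → ℝ} {C₀ : ℝ} {M₀ M₁ N N' : ℝ≥0}
    (hK : Measurable (Function.uncurry K)) (hreg : ∀ᵐ z, IsRegularPoint V K z)
    (hM : ∀ f : SpaceTime d → V, IsBddCompactSupp f →
      ∫⁻ z, squareIntegral (kernelTransform K f) z ≤ M₀ ^ 2 * ∫⁻ z, ‖f z‖ₑ ^ 2)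
    (hH : HormanderCondition κ C₀ M₁ K) (hf : IsBddCompactSupp f)
    {Q : Set (SpaceTime d)} (hQm : MeasurableSet Q) (hQ : volume Q ≠ ⊤) {δ : ℝ} (hδ : 0 < δ)
    {z₀ : SpaceTime d} (hQc : Q ⊆ cylinder κ δ z₀)
    (hN' : volume (cylinder κ (C₀ * δ) z₀) ≤ N' * volume Q) {τ η r : ℝ≥0} (hη : η ≤ 1)
    (hr : r ^ 2 = η * τ)
    (hlow : τ * volume Q < ∫⁻ z in Q, squareIntegral (kernelTransform K f) z)
    (hupp : ∫⁻ z in Q, squareIntegral (kernelTransform K f) z ≤ N * τ * volume Q) :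
    ∫⁻ z in Q, (squareIntegral (kernelTransform K f) z - (32 * N + 32 * M₁ + 1 : ℝ≥0) * τ)
      ≤ (∫⁻ z in Q, 34 * squareIntegral (kernelTransform K (f - {w | ‖f w‖ₑ ≤ r}.indicator f)) z)
        + (20 * M₀ ^ 2 * N' * η : ℝ≥0) * (τ * volume Q) := by
  have hrm : MeasurableSet {w | ‖f w‖ₑ ≤ r} :=
    measurableSet_le hf.stronglyMeasurable.enorm measurable_const
  have hcyl : MeasurableSet (cylinder κ (C₀ * δ) z₀) := measurableSet_Ioo.prod measurableSet_ball
  -- Only the small values are localized. The large part `f - h` does not depend on the cell, so its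
  -- contributions over disjoint cells add up to one global `L²` norm.
  set h : SpaceTime d → V := {w | ‖f w‖ₑ ≤ r}.indicator f with hh
  set h₁ : SpaceTime d → V := (cylinder κ (C₀ * δ) z₀).indicator h with hh₁
  have hhB : IsBddCompactSupp h := hf.indicator hrm
  have hh₁B : IsBddCompactSupp h₁ := hhB.indicator hcyl
  have hhr : ∀ w, ‖h w‖ₑ ≤ r := by
    intro w
    by_cases hw : ‖f w‖ₑ ≤ r
    · rwa [hh, indicator_of_mem (show w ∈ {w | ‖f w‖ₑ ≤ r} from hw)]
    · rw [hh, indicator_of_notMem (show w ∉ {w | ‖f w‖ₑ ≤ r} from hw)]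
      simp
  have hsub0 : ∀ w ∈ cylinder κ (C₀ * δ) z₀, (h - h₁) w = 0 := by
    intro w hw
    rw [Pi.sub_apply, hh₁, indicator_of_mem hw, sub_self]
  have hsubr : ∀ w, ‖(h - h₁) w‖ₑ ≤ r := by
    intro w
    by_cases hw : w ∈ cylinder κ (C₀ * δ) z₀
    · rw [hsub0 w hw]
      simp
    · rw [Pi.sub_apply, hh₁, indicator_of_notMem hw, sub_zero]
      exact hhr w
  have meas : ∀ g : SpaceTime d → V, IsBddCompactSupp g →
      Measurable (squareIntegral (kernelTransform K g)) := fun g hg =>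
    measurable_squareIntegral (stronglyMeasurable_kernelTransform hK hg.stronglyMeasurable)
  set G := squareIntegral (kernelTransform K f) with hG
  set B := squareIntegral (kernelTransform K (f - h)) with hB
  set S := squareIntegral (kernelTransform K h₁) with hS
  have mG : Measurable G := meas f hf
  have mB : Measurable B := meas _ (hf.sub hhB)
  have mS : Measurable S := meas _ hh₁B
  set m := volume Q with hm
  -- The strict lower bound on the average rules out null cells, over which one cannot average.
  have hm0 : m ≠ 0 := by
    intro h0
    rw [setLIntegral_measure_zero Q _ h0, h0, mul_zero] at hlow
    exact lt_irrefl _ hlow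
  have hrτ : (r : ℝ≥0∞) ^ 2 ≤ τ := by
    have : r ^ 2 ≤ τ := by
      rw [hr]
      exact mul_le_of_le_one_left zero_le hη
    exact_mod_cast this
  -- The averages over `z'` in `Q`. Integrating the constant `c` over `Q` returns `32 ∫_Q B + 16 ∫_Q
  -- S`; with the pointwise terms `2 B + 4 S` this makes `34` and `20`.
  set c : ℝ≥0∞ := m⁻¹ * (32 * ∫⁻ z in Q, B z) + m⁻¹ * (16 * ∫⁻ z in Q, S z) with hc
  have hpt : ∀ᵐ z ∂(volume.restrict Q), G z - (32 * N + 32 * M₁ + 1 : ℝ≥0) * τ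
      ≤ 2 * B z + 4 * S z + c := by
    filter_upwards [ae_restrict_of_ae hreg, ae_restrict_mem hQm] with z hz hzQ
    have havg : m * G z ≤ m * (2 * B z + 4 * S z + 32 * r ^ 2 * M₁)
        + (32 * (∫⁻ w in Q, G w) + 32 * (∫⁻ w in Q, B w) + 16 * ∫⁻ w in Q, S w) := by
      have h1 : ∫⁻ _w in Q, G z ≤ ∫⁻ w in Q, ((2 * B z + 4 * S z + 32 * r ^ 2 * M₁)
          + (32 * G w + 32 * B w + 16 * S w)) := by
        refine lintegral_mono_ae ?_
        filter_upwards [ae_restrict_of_ae hreg, ae_restrict_mem hQm] with w hw hwQ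
        exact IsRegularPoint.squareIntegral_le_of_mem_cylinder hK hH hδ hz hw (hQc hzQ) (hQc hwQ)
          hf hhB hh₁B hsubr hsub0
      rw [setLIntegral_const, lintegral_add_left measurable_const, setLIntegral_const,
        lintegral_add_left (by fun_prop), lintegral_add_left (by fun_prop),
        lintegral_const_mul _ mG, lintegral_const_mul _ mB, lintegral_const_mul _ mS] at h1
      rwa [mul_comm m, mul_comm m]
    rw [tsub_le_iff_right]
    calc G z = m⁻¹ * (m * G z) := by
          rw [← mul_assoc, ENNReal.inv_mul_cancel hm0 hQ, one_mul]
      _ ≤ m⁻¹ * (m * (2 * B z + 4 * S z + 32 * r ^ 2 * M₁)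
        + (32 * (N * τ * m) + 32 * (∫⁻ w in Q, B w) + 16 * ∫⁻ w in Q, S w)) := by
          gcongr m⁻¹ * ?_
          refine havg.trans ?_
          gcongr
      _ = m⁻¹ * m * (2 * B z + 4 * S z + 32 * r ^ 2 * M₁) + m⁻¹ * m * (32 * (N * τ)) + c := by
          rw [hc]
          ring
      _ = 2 * B z + 4 * S z + c + (32 * N * τ + 32 * M₁ * r ^ 2) := by
          rw [ENNReal.inv_mul_cancel hm0 hQ]
          ring
      _ ≤ 2 * B z + 4 * S z + c + (32 * N + 32 * M₁ + 1 : ℝ≥0) * τ := by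
          gcongr
          push_cast
          rw [add_mul, add_mul]
          refine le_add_right ?_
          gcongr
  -- `h₁` is bounded by `r` and lives on a cylinder of volume at most `N' m`, so its `L²` norm
  -- squared carries the small factor `η`.
  have hSint : ∫⁻ z in Q, S z ≤ M₀ ^ 2 * (η * τ * (N' * m)) := by
    calc ∫⁻ z in Q, S z ≤ ∫⁻ z, S z := setLIntegral_le_lintegral _ _
      _ ≤ M₀ ^ 2 * ∫⁻ z, ‖h₁ z‖ₑ ^ 2 := hM _ hh₁B
      _ ≤ M₀ ^ 2 * ∫⁻ z, (cylinder κ (C₀ * δ) z₀).indicator (fun _ => (r : ℝ≥0∞) ^ 2) z := by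
          gcongr with z
          by_cases hz : z ∈ cylinder κ (C₀ * δ) z₀
          · rw [hh₁, indicator_of_mem hz, indicator_of_mem hz]
            gcongr
            exact hhr z
          · rw [hh₁, indicator_of_notMem hz, indicator_of_notMem hz]
            simp
      _ = M₀ ^ 2 * (r ^ 2 * volume (cylinder κ (C₀ * δ) z₀)) := by
          rw [lintegral_indicator hcyl, setLIntegral_const]
      _ ≤ _ := by
          have : (r : ℝ≥0∞) ^ 2 = η * τ := by exact_mod_cast hr
          rw [this]
          gcongr
  calc _ ≤ ∫⁻ z in Q, (2 * B z + 4 * S z + c) := lintegral_mono_ae hpt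
    _ = 2 * (∫⁻ z in Q, B z) + 4 * (∫⁻ z in Q, S z) + c * m := by
        rw [lintegral_add_right _ measurable_const, lintegral_add_left (by fun_prop),
          lintegral_const_mul _ mB, lintegral_const_mul _ mS, setLIntegral_const]
    _ = 2 * (∫⁻ z in Q, B z) + 4 * (∫⁻ z in Q, S z) + m⁻¹ * m * (32 * (∫⁻ z in Q, B z)
          + 16 * ∫⁻ z in Q, S z) := by
        rw [hc]
        ring
    _ = 34 * (∫⁻ z in Q, B z) + 20 * ∫⁻ z in Q, S z := by
        rw [ENNReal.inv_mul_cancel hm0 hQ]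
        ring
    _ ≤ 34 * (∫⁻ z in Q, B z) + 20 * (M₀ ^ 2 * (η * τ * (N' * m))) := by gcongr
    _ = _ := by
        rw [lintegral_const_mul _ mB]
        push_cast
        ring

/-- The `L^p` estimate for bounded functions of bounded support. -/
theorem exists_lintegral_squareIntegral_rpow_le (d : ℕ) (l : ℝ → ℝ) {C₀ : ℝ} (hC₀ : 0 < C₀)
    (M₀ M₁ : ℝ≥0) {p : ℝ} (hp : 2 < p) :
    ∃ A : ℝ≥0, ∀ κ : ℝ → ℝ, IsScalingFunction κ → IsScalingFactor κ l →
      ∀ (V : Type*) [NormedAddCommGroup V] [InnerProductSpace ℝ V] [CompleteSpace V]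
        (K : SpaceTime d → SpaceTime d → ℝ), Measurable (Function.uncurry K) →
      (∀ᵐ z, IsRegularPoint V K z) →
      (∀ f : SpaceTime d → V, IsBddCompactSupp f →
        ∫⁻ z, squareIntegral (kernelTransform K f) z ≤ M₀ ^ 2 * ∫⁻ z, ‖f z‖ₑ ^ 2) →
      HormanderCondition κ C₀ M₁ K →
      ∀ f : SpaceTime d → V, IsBddCompactSupp f →
        ∫⁻ z, squareIntegral (kernelTransform K f) z ^ (p / 2) ≤ A * ∫⁻ z, ‖f z‖ₑ ^ p := by
  obtain ⟨N, N', hD⟩ := exists_dyadicSystem d l hC₀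
  have hs : 0 < p / 2 - 1 := by linarith
  have hC : 1 ≤ 32 * N + 32 * M₁ + 1 := le_add_self
  -- `34 M₀²` comes from the large part of `f`, and `40 = 2 · 20` from the factor `2 β` in the
  -- stopping estimate. `A` and `η` are fixed before `κ`, `V` and `K`.
  obtain ⟨A, η, hη0, hη1, hA⟩ := exists_lintegral_rpow_le (volume : Measure (SpaceTime d)) hs
    (34 * M₀ ^ 2) (40 * M₀ ^ 2 * N') hC
  refine ⟨A, fun κ hκ hl V _ _ _ K hK hreg hM hH f hf => ?_⟩
  obtain ⟨D, hDc⟩ := hD κ hκ hl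
  have mG : Measurable (squareIntegral (kernelTransform K f)) :=
    measurable_squareIntegral (stronglyMeasurable_kernelTransform hK hf.stronglyMeasurable)
  have mU : Measurable fun z => ‖f z‖ₑ ^ 2 := hf.stronglyMeasurable.enorm.pow_const 2
  have hL2 : ∫⁻ z, ‖f z‖ₑ ^ 2 ≠ ⊤ := by
    have := (hf.memLp 2).eLpNorm_lt_top
    rw [eLpNorm_two_eq] at this
    intro h
    rw [h] at this
    simp at this
  have hGfin : ∫⁻ z, squareIntegral (kernelTransform K f) z ≠ ⊤ :=
    ((hM f hf).trans_lt (ENNReal.mul_lt_top (by finiteness) hL2.lt_top)).ne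
  have key := hA (squareIntegral (kernelTransform K f)) (fun z => ‖f z‖ₑ ^ 2) mG mU hGfin ?_
  · have e : ∀ z, (‖f z‖ₑ ^ 2) ^ (1 + (p / 2 - 1)) = ‖f z‖ₑ ^ p := by
      intro z
      rw [← ENNReal.rpow_natCast_mul]
      congr 1
      push_cast
      ring
    simp_rw [e] at key
    rwa [add_sub_cancel] at key
  intro τ hτ
  set r : ℝ≥0 := NNReal.sqrt (η * τ) with hrdef
  have hr : r ^ 2 = η * τ := NNReal.sq_sqrt _
  have hrm : MeasurableSet {w | ‖f w‖ₑ ≤ r} :=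
    measurableSet_le hf.stronglyMeasurable.enorm measurable_const
  have hbB := hf.sub (hf.indicator hrm)
  have h1 := D.lintegral_tsub_le (W := fun z => 34 * squareIntegral (kernelTransform K
    (f - {w | ‖f w‖ₑ ≤ r}.indicator f)) z) (β := 20 * M₀ ^ 2 * N' * η) mG hGfin hτ hC
    (fun n z hlow hupp => by
      obtain ⟨δ, hδ, hsub, hvol⟩ := hDc n z
      exact setLIntegral_squareIntegral_tsub_le hK hreg hM hH hf (D.measurableSet_cell n z)
        (D.measure_ne_top n z) hδ hsub hvol hη1 hr hlow hupp)
  refine h1.trans (add_le_add ?_ (le_of_eq ?_))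
  · rw [lintegral_const_mul _ (measurable_squareIntegral
      (stronglyMeasurable_kernelTransform hK hbB.stronglyMeasurable))]
    push_cast
    rw [mul_assoc]
    gcongr
    refine (hM _ hbB).trans ?_
    gcongr with z
    by_cases hz : ‖f z‖ₑ ≤ r
    · rw [Pi.sub_apply, indicator_of_mem (show z ∈ {w | ‖f w‖ₑ ≤ r} from hz), sub_self]
      simp
    · have hz' : (η * τ : ℝ≥0∞) < ‖f z‖ₑ ^ 2 := by
        have : (η * τ : ℝ≥0∞) = (r : ℝ≥0∞) ^ 2 := by exact_mod_cast hr.symm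
        rw [this]
        exact ENNReal.pow_right_strictMono two_ne_zero (not_le.1 hz)
      rw [indicator_of_mem (show z ∈ {z | (η * τ : ℝ≥0∞) < ‖f z‖ₑ ^ 2} from hz'), Pi.sub_apply,
        indicator_of_notMem (show z ∉ {w | ‖f w‖ₑ ≤ r} from hz), sub_zero]
  · push_cast
    ring

end CellEstimate

/-! ### Truncation and the `L²`-extension. -/

section Extension

set_option linter.unusedSectionVars false

variable {d : ℕ} {V : Type*} [NormedAddCommGroup V] [InnerProductSpace ℝ V] [CompleteSpace V]
  {K : SpaceTime d → SpaceTime d → ℝ} {f : SpaceTime d → V} {F : SpaceTime d → ℝ → V}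

/-- The truncation of `f` in height and in space. -/
noncomputable def truncation (f : SpaceTime d → V) (n : ℕ) : SpaceTime d → V :=
  ({z | ‖f z‖ ≤ n} ∩ Metric.closedBall 0 n).indicator f

theorem isBddCompactSupp_truncation (hf : StronglyMeasurable f) (n : ℕ) :
    IsBddCompactSupp (truncation f n) := by
  refine ⟨hf.indicator ((measurableSet_le hf.norm.measurable measurable_const).inter
    measurableSet_closedBall), ⟨n, fun z => ?_⟩, ⟨n, fun z hz => ?_⟩⟩
  · by_cases hz : z ∈ {z | ‖f z‖ ≤ n} ∩ Metric.closedBall 0 n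
    · rw [truncation, indicator_of_mem hz]
      exact hz.1
    · rw [truncation, indicator_of_notMem hz, norm_zero]
      exact Nat.cast_nonneg n
  · refine indicator_of_notMem (fun h => ?_) _
    have := mem_closedBall_zero_iff.1 h.2
    linarith

theorem norm_truncation_le (f : SpaceTime d → V) (n : ℕ) (z : SpaceTime d) :
    ‖truncation f n z‖ ≤ ‖f z‖ :=
  norm_indicator_le_norm_self _ _

theorem enorm_truncation_le (f : SpaceTime d → V) (n : ℕ) (z : SpaceTime d) :
    ‖truncation f n z‖ₑ ≤ ‖f z‖ₑ :=
  enorm_indicator_le_enorm_self _ _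

theorem tendsto_truncation (f : SpaceTime d → V) (z : SpaceTime d) :
    Tendsto (fun n => truncation f n z) atTop (𝓝 (f z)) := by
  refine tendsto_const_nhds.congr' ?_
  obtain ⟨m, hm⟩ := exists_nat_ge (max ‖f z‖ ‖z‖)
  filter_upwards [eventually_ge_atTop m] with n hn
  have hmn : max ‖f z‖ ‖z‖ ≤ n := hm.trans (by exact_mod_cast hn)
  have hz : z ∈ {z | ‖f z‖ ≤ n} ∩ Metric.closedBall 0 n :=
    ⟨(le_max_left _ _).trans hmn, mem_closedBall_zero_iff.2 ((le_max_right _ _).trans hmn)⟩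
  exact (indicator_of_mem hz f).symm

theorem tendsto_lintegral_truncation_sub (hf : StronglyMeasurable f)
    (hf2 : ∫⁻ z, ‖f z‖ₑ ^ 2 ≠ ⊤) :
    Tendsto (fun n => ∫⁻ z, ‖truncation f n z - f z‖ₑ ^ 2) atTop (𝓝 0) := by
  have h := tendsto_lintegral_of_dominated_convergence (μ := (volume : Measure (SpaceTime d)))
    (F := fun n z => ‖truncation f n z - f z‖ₑ ^ 2) (f := fun _ => 0) (fun z => 4 * ‖f z‖ₑ ^ 2)
    (fun n => ((isBddCompactSupp_truncation hf n).stronglyMeasurable.sub hf).enorm.pow_const 2)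
    (fun n => Eventually.of_forall fun z => ?_) ?_ (Eventually.of_forall fun z => ?_)
  · simpa using h
  · refine (enorm_sub_sq_le _ _).trans ?_
    calc 2 * ‖truncation f n z‖ₑ ^ 2 + 2 * ‖f z‖ₑ ^ 2 ≤ 2 * ‖f z‖ₑ ^ 2 + 2 * ‖f z‖ₑ ^ 2 := by
          gcongr
          exact enorm_truncation_le f n z
      _ = 4 * ‖f z‖ₑ ^ 2 := by ring
  · rw [lintegral_const_mul' _ _ (by simp)]
    exact ENNReal.mul_ne_top (by simp) hf2
  · have h1 : Tendsto (fun n => truncation f n z - f z) atTop (𝓝 0) := by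
      simpa using (tendsto_truncation f z).sub_const (f z)
    have h2 := (ENNReal.continuous_pow 2).continuousAt.tendsto.comp h1.enorm
    simpa [Function.comp_def] using h2

theorem eLpNorm_uncurry_eq (hF : AEStronglyMeasurable (Function.uncurry F) volume) :
    eLpNorm (Function.uncurry F) 2 volume = eLpNorm (squareFunction F) 2 volume := by
  rw [eLpNorm_squareFunction_two, eLpNorm_eq_lintegral_rpow_enorm_toReal (by simp) (by simp),
    Measure.volume_eq_prod, lintegral_prod _ (hF.enorm.pow_const _)]
  simp [squareIntegral]

theorem eLpNorm_uncurry_sub_eq {F G : SpaceTime d → ℝ → V}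
    (hF : AEStronglyMeasurable (Function.uncurry F) volume)
    (hG : AEStronglyMeasurable (Function.uncurry G) volume) :
    eLpNorm (Function.uncurry F - Function.uncurry G) 2 volume
      = eLpNorm (squareFunction (F - G)) 2 volume := by
  have h : Function.uncurry (F - G) = Function.uncurry F - Function.uncurry G := rfl
  rw [← eLpNorm_uncurry_eq (F := F - G) (h ▸ hF.sub hG), h]

theorem tendsto_rpow_half_zero_iff {u : ℕ → ℝ≥0∞} :
    Tendsto (fun n => u n ^ (1 / 2 : ℝ)) atTop (𝓝 0) ↔ Tendsto u atTop (𝓝 0) := by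
  constructor <;> intro h
  · have h1 := (ENNReal.continuous_rpow_const (y := 2)).continuousAt.tendsto.comp h
    have h2 : ∀ n, ((u n) ^ (1 / 2 : ℝ)) ^ (2 : ℝ) = u n := fun n => by
      rw [← ENNReal.rpow_mul]
      norm_num
    simpa only [Function.comp_def, h2, ENNReal.zero_rpow_of_pos two_pos] using h1
  · have h1 := (ENNReal.continuous_rpow_const (y := 1 / 2)).continuousAt.tendsto.comp h
    simpa [Function.comp_def] using h1

theorem tendsto_lintegral_iff_eLpNorm_two (g : ℕ → SpaceTime d → V) :
    Tendsto (fun n => eLpNorm (g n) 2 volume) atTop (𝓝 0) ↔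
      Tendsto (fun n => ∫⁻ z, ‖g n z‖ₑ ^ 2) atTop (𝓝 0) := by
  simp_rw [eLpNorm_two_eq]
  exact tendsto_rpow_half_zero_iff

theorem tendsto_lintegral_iff_squareFunction (H : ℕ → SpaceTime d → ℝ → V) :
    Tendsto (fun n => eLpNorm (squareFunction (H n)) 2 volume) atTop (𝓝 0) ↔
      Tendsto (fun n => ∫⁻ z, squareIntegral (H n) z) atTop (𝓝 0) := by
  simp_rw [eLpNorm_squareFunction_two]
  exact tendsto_rpow_half_zero_iff

/-- The `L²`-extension is the limit of the transforms of truncations. -/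
theorem IsL2Transform.tendsto_truncation (hK : Measurable (Function.uncurry K))
    (hreg : ∀ᵐ z, IsRegularPoint V K z) {M₀ : ℝ≥0}
    (hM : ∀ f : SpaceTime d → V, IsBddCompactSupp f →
      ∫⁻ z, squareIntegral (kernelTransform K f) z ≤ M₀ ^ 2 * ∫⁻ z, ‖f z‖ₑ ^ 2)
    (hf : StronglyMeasurable f) (hf2 : ∫⁻ z, ‖f z‖ₑ ^ 2 ≠ ⊤) (hF : IsL2Transform K f F) :
    Tendsto (fun n => ∫⁻ z, squareIntegral (kernelTransform K (truncation f n) - F) z)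
      atTop (𝓝 0) := by
  obtain ⟨-, φ, hφ, h1, h2⟩ := hF
  rw [tendsto_lintegral_iff_eLpNorm_two] at h1
  rw [tendsto_lintegral_iff_squareFunction] at h2
  -- Compare with the approximants `φ m` that define `F`, use the `L²` bound on `truncation f n - φ
  -- m`, and let `m → ∞` at fixed `n`.
  have hb : ∀ n, ∫⁻ z, squareIntegral (kernelTransform K (truncation f n) - F) z
      ≤ 4 * M₀ ^ 2 * ∫⁻ z, ‖truncation f n z - f z‖ₑ ^ 2 := by
    intro n
    have hT := isBddCompactSupp_truncation hf n
    have hbound : ∀ m, ∫⁻ z, squareIntegral (kernelTransform K (truncation f n) - F) z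
        ≤ 4 * M₀ ^ 2 * (∫⁻ z, ‖truncation f n z - f z‖ₑ ^ 2)
          + (4 * M₀ ^ 2 * (∫⁻ z, ‖(φ m - f) z‖ₑ ^ 2)
          + 2 * ∫⁻ z, squareIntegral (kernelTransform K (φ m) - F) z) := by
      intro m
      have hφm := (hφ m).isBddCompactSupp
      set A := kernelTransform K (truncation f n) with hA
      set B := kernelTransform K (φ m) with hB
      have mA : StronglyMeasurable (Function.uncurry A) :=
        stronglyMeasurable_kernelTransform hK hT.stronglyMeasurable
      have mB : StronglyMeasurable (Function.uncurry B) :=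
        stronglyMeasurable_kernelTransform hK hφm.stronglyMeasurable
      have mAB : StronglyMeasurable (Function.uncurry (A - B)) := mA.sub mB
      have e1 : ∫⁻ z, squareIntegral (A - B) z
          ≤ M₀ ^ 2 * (2 * (∫⁻ z, ‖truncation f n z - f z‖ₑ ^ 2)
            + 2 * ∫⁻ z, ‖(φ m - f) z‖ₑ ^ 2) := by
        calc ∫⁻ z, squareIntegral (A - B) z
            = ∫⁻ z, squareIntegral (kernelTransform K (truncation f n - φ m)) z := by
              refine lintegral_congr_ae ?_
              filter_upwards [hreg] with z hz
              exact (hz.squareIntegral_sub_eq hT hφm).symm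
          _ ≤ M₀ ^ 2 * ∫⁻ z, ‖(truncation f n - φ m) z‖ₑ ^ 2 := hM _ (hT.sub hφm)
          _ ≤ M₀ ^ 2 * ∫⁻ z, (2 * ‖truncation f n z - f z‖ₑ ^ 2 + 2 * ‖(φ m - f) z‖ₑ ^ 2) := by
              gcongr with z
              have : (truncation f n - φ m) z = (truncation f n z - f z) - (φ m - f) z := by
                simp
              rw [this]
              exact enorm_sub_sq_le _ _
          _ = _ := by
              have m1 : Measurable fun z => ‖truncation f n z - f z‖ₑ ^ 2 :=
                (hT.stronglyMeasurable.sub hf).enorm.pow_const 2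
              rw [lintegral_add_left (m1.const_mul 2), lintegral_const_mul' _ _ (by simp),
                lintegral_const_mul' _ _ (by simp)]
      calc ∫⁻ z, squareIntegral (A - F) z
          ≤ ∫⁻ z, (2 * squareIntegral (A - B) z + 2 * squareIntegral (B - F) z) := by
            refine lintegral_mono fun z => ?_
            have h3 : A - F = (A - B) - (F - B) := by simp
            have h4 : squareIntegral (F - B) z = squareIntegral (B - F) z :=
              lintegral_congr fun s => by
                simp only [Pi.sub_apply]
                rw [enorm_sub_rev]
            rw [h3, ← h4]
            exact squareIntegral_sub_le mAB z
        _ = 2 * (∫⁻ z, squareIntegral (A - B) z) + 2 * ∫⁻ z, squareIntegral (B - F) z := by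
            rw [lintegral_add_left ((measurable_squareIntegral mAB).const_mul 2),
              lintegral_const_mul' _ _ (by simp), lintegral_const_mul' _ _ (by simp)]
        _ ≤ 2 * (M₀ ^ 2 * (2 * (∫⁻ z, ‖truncation f n z - f z‖ₑ ^ 2)
            + 2 * ∫⁻ z, ‖(φ m - f) z‖ₑ ^ 2)) + 2 * ∫⁻ z, squareIntegral (B - F) z := by
            gcongr
        _ = _ := by ring
    have hlim : Tendsto (fun m => 4 * M₀ ^ 2 * (∫⁻ z, ‖truncation f n z - f z‖ₑ ^ 2)
          + (4 * M₀ ^ 2 * (∫⁻ z, ‖(φ m - f) z‖ₑ ^ 2)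
          + 2 * ∫⁻ z, squareIntegral (kernelTransform K (φ m) - F) z)) atTop
        (𝓝 (4 * M₀ ^ 2 * (∫⁻ z, ‖truncation f n z - f z‖ₑ ^ 2) + (4 * M₀ ^ 2 * 0 + 2 * 0))) :=
      tendsto_const_nhds.add ((ENNReal.Tendsto.const_mul h1 (Or.inr (by finiteness))).add
        (ENNReal.Tendsto.const_mul h2 (Or.inr (by simp))))
    have := ge_of_tendsto' hlim hbound
    simpa using this
  have hz : Tendsto (fun n => 4 * (M₀ : ℝ≥0∞) ^ 2 * ∫⁻ z, ‖truncation f n z - f z‖ₑ ^ 2) atTop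
      (𝓝 (4 * (M₀ : ℝ≥0∞) ^ 2 * 0)) :=
    ENNReal.Tendsto.const_mul (tendsto_lintegral_truncation_sub hf hf2) (Or.inr (by finiteness))
  rw [mul_zero] at hz
  exact tendsto_of_tendsto_of_tendsto_of_le_of_le tendsto_const_nhds hz (fun _ => zero_le) hb

theorem exists_subseq_tendsto_ae {H : ℕ → SpaceTime d → ℝ → V}
    (hH : ∀ n, StronglyMeasurable (Function.uncurry (H n)))
    (hF : AEStronglyMeasurable (Function.uncurry F) volume)
    (h : Tendsto (fun n => ∫⁻ z, squareIntegral (H n - F) z) atTop (𝓝 0)) :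
    ∃ ns : ℕ → ℕ, StrictMono ns ∧
      ∀ᵐ z, ∀ᵐ s, Tendsto (fun k => H (ns k) z s) atTop (𝓝 (F z s)) := by
  have h1 : Tendsto (fun n => eLpNorm (Function.uncurry (H n) - Function.uncurry F) 2 volume)
      atTop (𝓝 0) := by
    rw [← tendsto_lintegral_iff_squareFunction] at h
    exact h.congr fun n => (eLpNorm_uncurry_sub_eq (hH n).aestronglyMeasurable hF).symm
  obtain ⟨ns, hns, hlim⟩ := (tendstoInMeasure_of_tendsto_eLpNorm (by simp)
    (fun n => (hH n).aestronglyMeasurable) hF h1).exists_seq_tendsto_ae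
  exact ⟨ns, hns, Measure.ae_ae_of_ae_prod hlim⟩

theorem tendsto_kernelTransform_truncation (hK : Measurable (Function.uncurry K))
    (hf : StronglyMeasurable f) {z : SpaceTime d} {s : ℝ}
    (hint : Integrable (fun y => K z (s, y) • f (s, y)) volume) :
    Tendsto (fun n => kernelTransform K (truncation f n) z s) atTop
      (𝓝 (kernelTransform K f z s)) := by
  have hKz : Measurable (K z) := hK.comp measurable_prodMk_left
  refine tendsto_integral_of_dominated_convergence _ (fun n => ?_) hint.norm
    (fun n => Eventually.of_forall fun y => ?_) (Eventually.of_forall fun y => ?_)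
  · exact (hKz.comp measurable_prodMk_left).aestronglyMeasurable.smul
      ((isBddCompactSupp_truncation hf n).stronglyMeasurable.comp_measurable
        measurable_prodMk_left).aestronglyMeasurable
  · rw [norm_smul, norm_smul]
    gcongr
    exact norm_truncation_le f n _
  · exact (tendsto_truncation f _).const_smul _

/-- By Fubini, `f` and `g` agree for almost every `y` on almost every time slice. The exceptional
`s` depend on neither `z` nor `K`. -/
theorem kernelTransform_congr_ae {g : SpaceTime d → V} (h : f =ᵐ[volume] g) :
    ∀ᵐ s, ∀ z, kernelTransform K f z s = kernelTransform K g z s ∧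
      (Integrable (fun y => K z (s, y) • f (s, y)) volume ↔
        Integrable (fun y => K z (s, y) • g (s, y)) volume) := by
  have h1 : ∀ᵐ s : ℝ, ∀ᵐ y, f (s, y) = g (s, y) := Measure.ae_ae_of_ae_prod h
  filter_upwards [h1] with s hs z
  have : (fun y => K z (s, y) • f (s, y)) =ᵐ[volume] fun y => K z (s, y) • g (s, y) := by
    filter_upwards [hs] with y hy
    rw [hy]
  exact ⟨integral_congr_ae this, integrable_congr this⟩

theorem exists_isL2Transform (hK : Measurable (Function.uncurry K))
    (hreg : ∀ᵐ z, IsRegularPoint V K z) {M₀ : ℝ≥0}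
    (hM : ∀ f : SpaceTime d → V, IsBddCompactSupp f →
      ∫⁻ z, squareIntegral (kernelTransform K f) z ≤ M₀ ^ 2 * ∫⁻ z, ‖f z‖ₑ ^ 2)
    (hf : MemLp f 2 volume) : ∃ F, IsL2Transform K f F := by
  have hpos : ∀ n : ℕ, (0 : ℝ) < (1 / 2) ^ n := fun n => by positivity
  choose φ hφc hφs hφ using fun n : ℕ => hf.exist_eLpNorm_sub_le (by simp) (by simp) (hpos n)
  have hφt : ∀ n, IsTestFunction (φ n) := fun n => ⟨hφs n, hφc n⟩
  have hφB : ∀ n, IsBddCompactSupp (φ n) := fun n => (hφt n).isBddCompactSupp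
  have hm : ∀ n, StronglyMeasurable (Function.uncurry (kernelTransform K (φ n))) := fun n =>
    stronglyMeasurable_kernelTransform hK (hφB n).stronglyMeasurable
  have hMem : ∀ n, MemLp (Function.uncurry (kernelTransform K (φ n))) 2 volume := by
    intro n
    refine ⟨(hm n).aestronglyMeasurable, ?_⟩
    rw [eLpNorm_uncurry_eq (hm n).aestronglyMeasurable]
    exact ((eLpNorm_squareFunction_two_le_iff _ _ _).2 (hM _ (hφB n))).trans_lt
      (ENNReal.mul_lt_top ENNReal.coe_lt_top ((hφB n).memLp 2).eLpNorm_lt_top)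
  -- The geometric rate of the `φ n` gives the summable Cauchy bound needed for completeness. The `+
  -- 1` keeps the inequality strict when `M₀ = 0`.
  have hcau : ∀ N n m : ℕ, N ≤ n → N ≤ m →
      eLpNorm (Function.uncurry (kernelTransform K (φ n))
        - Function.uncurry (kernelTransform K (φ m))) 2 volume
        < ENNReal.ofReal ((2 * M₀ + 1) * (1 / 2) ^ N) := by
    intro N n m hn hmN
    have e1 : eLpNorm (Function.uncurry (kernelTransform K (φ n))
        - Function.uncurry (kernelTransform K (φ m))) 2 volume
        ≤ M₀ * eLpNorm (φ n - φ m) 2 volume := by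
      rw [eLpNorm_uncurry_sub_eq (hm n).aestronglyMeasurable (hm m).aestronglyMeasurable,
        eLpNorm_squareFunction_two_le_iff]
      refine le_trans (le_of_eq ?_) (hM _ ((hφB n).sub (hφB m)))
      refine lintegral_congr_ae ?_
      filter_upwards [hreg] with z hz
      exact (hz.squareIntegral_sub_eq (hφB n) (hφB m)).symm
    have e2 : eLpNorm (φ n - φ m) 2 volume ≤ ENNReal.ofReal (2 * (1 / 2) ^ N) := by
      have h2 : φ n - φ m = (f - φ m) - (f - φ n) := by simp
      have hle : ∀ k, N ≤ k → eLpNorm (f - φ k) 2 volume ≤ ENNReal.ofReal ((1 / 2) ^ N) :=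
        fun k hk => (hφ k).trans (ENNReal.ofReal_le_ofReal
          (pow_le_pow_of_le_one (by norm_num) (by norm_num) hk))
      rw [h2]
      refine (eLpNorm_sub_le
        (hf.1.sub (hφB m).stronglyMeasurable.aestronglyMeasurable)
        (hf.1.sub (hφB n).stronglyMeasurable.aestronglyMeasurable) (by simp)).trans ?_
      refine (add_le_add (hle m hmN) (hle n hn)).trans (le_of_eq ?_)
      rw [← ENNReal.ofReal_add (hpos N).le (hpos N).le, two_mul]
    calc _ ≤ (M₀ : ℝ≥0∞) * ENNReal.ofReal (2 * (1 / 2) ^ N) := e1.trans (by gcongr)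
      _ = ENNReal.ofReal (M₀ * (2 * (1 / 2) ^ N)) := by
          rw [ENNReal.ofReal_mul (NNReal.coe_nonneg M₀), ENNReal.ofReal_coe_nnreal]
      _ < _ := by
          refine (ENNReal.ofReal_lt_ofReal_iff_of_nonneg (by positivity)).2 ?_
          have := hpos N
          linarith
  have hsum : ∑' N : ℕ, ENNReal.ofReal ((2 * M₀ + 1) * (1 / 2) ^ N) ≠ ⊤ :=
    (summable_geometric_two.mul_left _).tsum_ofReal_ne_top
  obtain ⟨G, hG, hlim⟩ := Lp.cauchy_complete_eLpNorm (by simp) hMem hsum hcau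
  refine ⟨Function.curry G, hG.1, φ, hφt, ?_, ?_⟩
  · refine tendsto_of_tendsto_of_tendsto_of_le_of_le tendsto_const_nhds
      (h := fun n => ENNReal.ofReal ((1 / 2) ^ n)) ?_ (fun _ => zero_le) fun n => ?_
    · have := ENNReal.tendsto_ofReal (tendsto_pow_atTop_nhds_zero_of_lt_one
        (by norm_num : (0 : ℝ) ≤ 1 / 2) (by norm_num))
      simpa using this
    · rw [eLpNorm_sub_comm]
      exact hφ n
  · refine hlim.congr fun n => ?_
    rw [← eLpNorm_uncurry_sub_eq (hm n).aestronglyMeasurable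
      (by rw [Function.uncurry_curry]; exact hG.1), Function.uncurry_curry]

/-- The `L²`-extension is given by the integral wherever the latter converges absolutely. -/
theorem IsL2Transform.ae_eq_kernelTransform (hK : Measurable (Function.uncurry K))
    (hreg : ∀ᵐ z, IsRegularPoint V K z) {M₀ : ℝ≥0}
    (hM : ∀ f : SpaceTime d → V, IsBddCompactSupp f →
      ∫⁻ z, squareIntegral (kernelTransform K f) z ≤ M₀ ^ 2 * ∫⁻ z, ‖f z‖ₑ ^ 2)
    (hf : StronglyMeasurable f) (hf2 : ∫⁻ z, ‖f z‖ₑ ^ 2 ≠ ⊤) (hF : IsL2Transform K f F) :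
    ∀ᵐ z, ∀ᵐ s, Integrable (fun y => K z (s, y) • f (s, y)) volume →
      F z s = kernelTransform K f z s := by
  obtain ⟨ns, hns, hlim⟩ := exists_subseq_tendsto_ae (fun n => stronglyMeasurable_kernelTransform hK
    (isBddCompactSupp_truncation hf n).stronglyMeasurable) hF.1
    (hF.tendsto_truncation hK hreg hM hf hf2)
  filter_upwards [hlim] with z hz
  filter_upwards [hz] with s hs hint
  exact tendsto_nhds_unique hs
    ((tendsto_kernelTransform_truncation hK hf hint).comp hns.tendsto_atTop)

/-- A power bound for bounded functions of bounded support passes to the `L²`-extension. -/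
theorem IsL2Transform.lintegral_squareIntegral_rpow_le (hK : Measurable (Function.uncurry K))
    (hreg : ∀ᵐ z, IsRegularPoint V K z) {M₀ : ℝ≥0}
    (hM : ∀ f : SpaceTime d → V, IsBddCompactSupp f →
      ∫⁻ z, squareIntegral (kernelTransform K f) z ≤ M₀ ^ 2 * ∫⁻ z, ‖f z‖ₑ ^ 2)
    {p : ℝ} (hp : 0 < p) {A : ℝ≥0}
    (hA : ∀ f : SpaceTime d → V, IsBddCompactSupp f →
      ∫⁻ z, squareIntegral (kernelTransform K f) z ^ (p / 2) ≤ A * ∫⁻ z, ‖f z‖ₑ ^ p)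
    (hf : StronglyMeasurable f) (hf2 : ∫⁻ z, ‖f z‖ₑ ^ 2 ≠ ⊤) (hF : IsL2Transform K f F) :
    ∫⁻ z, squareIntegral F z ^ (p / 2) ≤ A * ∫⁻ z, ‖f z‖ₑ ^ p := by
  have hm : ∀ n, StronglyMeasurable (Function.uncurry (kernelTransform K (truncation f n))) :=
    fun n => stronglyMeasurable_kernelTransform hK
      (isBddCompactSupp_truncation hf n).stronglyMeasurable
  obtain ⟨ns, hns, hlim⟩ := exists_subseq_tendsto_ae hm hF.1
    (hF.tendsto_truncation hK hreg hM hf hf2)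
  -- Fatou's lemma in `s`, followed below by Fatou's lemma in `z`. The right side is harmless
  -- because truncations are pointwise dominated by `f`.
  have hpt : ∀ᵐ z, squareIntegral F z ^ (p / 2) ≤ liminf
      (fun k => squareIntegral (kernelTransform K (truncation f (ns k))) z ^ (p / 2)) atTop := by
    filter_upwards [hlim] with z hz
    have h1 : squareIntegral F z
        ≤ liminf (fun k => squareIntegral (kernelTransform K (truncation f (ns k))) z) atTop := by
      calc squareIntegral F z
          ≤ ∫⁻ s, liminf (fun k => ‖kernelTransform K (truncation f (ns k)) z s‖ₑ ^ 2) atTop := by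
            refine lintegral_mono_ae ?_
            filter_upwards [hz] with s hs
            refine le_of_eq (Tendsto.liminf_eq ?_).symm
            exact (ENNReal.continuous_pow 2).continuousAt.tendsto.comp hs.enorm
        _ ≤ _ := lintegral_liminf_le fun k =>
            ((hm (ns k)).comp_measurable measurable_prodMk_left).enorm.pow_const 2
    refine (ENNReal.rpow_le_rpow h1 (by positivity)).trans (le_of_eq ?_)
    exact (ENNReal.monotone_rpow_of_nonneg (by positivity : 0 ≤ p / 2)).map_liminf_of_continuousAt
      _ ENNReal.continuous_rpow_const.continuousAt
  calc ∫⁻ z, squareIntegral F z ^ (p / 2)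
      ≤ ∫⁻ z, liminf (fun k =>
          squareIntegral (kernelTransform K (truncation f (ns k))) z ^ (p / 2)) atTop :=
        lintegral_mono_ae hpt
    _ ≤ liminf (fun k => ∫⁻ z,
          squareIntegral (kernelTransform K (truncation f (ns k))) z ^ (p / 2)) atTop :=
        lintegral_liminf_le fun k => (measurable_squareIntegral (hm _)).pow_const _
    _ ≤ liminf (fun _ : ℕ => A * ∫⁻ z, ‖f z‖ₑ ^ p) atTop := by
        refine liminf_le_liminf (Eventually.of_forall fun k => ?_)
        refine (hA _ (isBddCompactSupp_truncation hf _)).trans ?_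
        gcongr with z
        exact enorm_truncation_le f _ z
    _ = _ := liminf_const _

theorem eLpNorm_squareFunction_le {p : ℝ} (hp : 0 < p) {A : ℝ≥0}
    (h : ∫⁻ z, squareIntegral F z ^ (p / 2) ≤ A * ∫⁻ z, ‖f z‖ₑ ^ p) :
    eLpNorm (squareFunction F) (ENNReal.ofReal p) volume
      ≤ (A ^ (1 / p) : ℝ≥0) * eLpNorm f (ENNReal.ofReal p) volume := by
  rw [eLpNorm_squareFunction F hp, eLpNorm_eq_lintegral_rpow_enorm_toReal (by simpa using hp)
    ENNReal.ofReal_ne_top, ENNReal.toReal_ofReal hp.le,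
    ENNReal.coe_rpow_of_nonneg _ (by positivity), ← ENNReal.mul_rpow_of_nonneg _ _ (by positivity)]
  exact ENNReal.rpow_le_rpow h (by positivity)

end Extension

end StochHormander

/-! ### Assembly of the theorem. -/

theorem mainTheorem3 (d : ℕ) (l : ℝ → ℝ) (C₀ : ℝ) (hC₀ : 1 < C₀) (M₀ M₁ : ℝ≥0)
    (p : ℝ) (hp : 2 < p) :
    ∃ A : ℝ≥0, ∀ (κ : ℝ → ℝ), StochHormander.IsScalingFunction κ →
      StochHormander.IsScalingFactor κ l →
      ∀ (V : Type*) [NormedAddCommGroup V] [InnerProductSpace ℝ V] [CompleteSpace V]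
        [TopologicalSpace.SeparableSpace V]
        (K : StochHormander.SpaceTime d → StochHormander.SpaceTime d → ℝ),
      Measurable (Function.uncurry K) →
      (∀ᵐ z, ∀ f : StochHormander.SpaceTime d → V, StochHormander.IsTestFunction f →
        Integrable (fun w => K z w • f w) volume) →
      (∀ f : StochHormander.SpaceTime d → V, StochHormander.IsTestFunction f →
        eLpNorm (StochHormander.stochOperator K f) 2 volume ≤ M₀ * eLpNorm f 2 volume) →
      StochHormander.HormanderCondition κ C₀ M₁ K →
      ∀ f : StochHormander.SpaceTime d → V,
        MemLp f 2 volume → MemLp f (ENNReal.ofReal p) volume →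
        eLpNorm (StochHormander.stochOperator K f) (ENNReal.ofReal p) volume
            ≤ A * eLpNorm f (ENNReal.ofReal p) volume ∧
        (∃ F : StochHormander.SpaceTime d → ℝ → V, StochHormander.IsL2Transform K f F) ∧
        (∀ F : StochHormander.SpaceTime d → ℝ → V, StochHormander.IsL2Transform K f F →
          (∀ᵐ z, ∀ᵐ s, Integrable (fun y => K z (s, y) • f (s, y)) volume →
            F z s = StochHormander.kernelTransform K f z s) ∧
          eLpNorm (StochHormander.squareFunction F) (ENNReal.ofReal p) volume
            ≤ A * eLpNorm f (ENNReal.ofReal p) volume) := by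
  have hp0 : 0 < p := by linarith
  obtain ⟨A, hA⟩ := StochHormander.exists_lintegral_squareIntegral_rpow_le d l
    (zero_lt_one.trans hC₀) M₀ M₁ hp
  refine ⟨A ^ (1 / p), fun κ hκ hl V _ _ _ _ K hK hKi hL2 hH f hf2 _ => ?_⟩
  have hreg : ∀ᵐ z, StochHormander.IsRegularPoint V K z :=
    StochHormander.ae_integrable_smul hK hKi
  have hM : ∀ f : StochHormander.SpaceTime d → V, StochHormander.IsBddCompactSupp f →
      ∫⁻ z, StochHormander.squareIntegral (StochHormander.kernelTransform K f) z
        ≤ M₀ ^ 2 * ∫⁻ z, ‖f z‖ₑ ^ 2 := fun f hf =>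
    StochHormander.lintegral_squareIntegral_kernelTransform_le hK hKi hL2 hf
  have hAK := hA κ hκ hl V K hK hreg hM hH
  -- The truncation lemmas need a strongly measurable representative; an `L²`-extension of `f` is
  -- also one of `g`.
  set g := hf2.1.mk f with hg
  have hgm : StronglyMeasurable g := hf2.1.stronglyMeasurable_mk
  have hfg : f =ᵐ[volume] g := hf2.1.ae_eq_mk
  have hg2 : ∫⁻ z, ‖g z‖ₑ ^ 2 ≠ ⊤ := by
    have := (hf2.ae_eq hfg).eLpNorm_lt_top
    rw [StochHormander.eLpNorm_two_eq] at this
    intro h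
    rw [h] at this
    simp at this
  have hbound : ∀ F : StochHormander.SpaceTime d → ℝ → V, StochHormander.IsL2Transform K f F →
      (∀ᵐ z, ∀ᵐ s, Integrable (fun y => K z (s, y) • f (s, y)) volume →
        F z s = StochHormander.kernelTransform K f z s) ∧
      ∫⁻ z, StochHormander.squareIntegral F z ^ (p / 2) ≤ A * ∫⁻ z, ‖f z‖ₑ ^ p := by
    rintro F ⟨hFm, φ, hφ, h1, h2⟩
    have hFg : StochHormander.IsL2Transform K g F := by
      refine ⟨hFm, φ, hφ, h1.congr fun n => ?_, h2⟩
      exact eLpNorm_congr_ae (EventuallyEq.rfl.sub hfg)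
    constructor
    · filter_upwards [hFg.ae_eq_kernelTransform hK hreg hM hgm hg2] with z hz
      filter_upwards [hz, StochHormander.kernelTransform_congr_ae (K := K) hfg] with s hs hs' hint
      rw [(hs' z).1]
      exact hs ((hs' z).2.1 hint)
    · refine (hFg.lintegral_squareIntegral_rpow_le hK hreg hM hp0 hAK hgm hg2).trans
        (le_of_eq ?_)
      congr 1
      refine lintegral_congr_ae ?_
      filter_upwards [hfg] with z hz
      rw [hz]
  obtain ⟨F, hF⟩ := StochHormander.exists_isL2Transform hK hreg hM hf2
  refine ⟨StochHormander.eLpNorm_squareFunction_le hp0 ?_, ⟨F, hF⟩, fun F hF =>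
    ⟨(hbound F hF).1, StochHormander.eLpNorm_squareFunction_le hp0 (hbound F hF).2⟩⟩
  refine (lintegral_mono_ae ?_).trans (hbound F hF).2
  filter_upwards [(hbound F hF).1] with z hz
  refine ENNReal.rpow_le_rpow (lintegral_mono_ae ?_) (by positivity)
  filter_upwards [hz] with s hs
  -- The bound for `𝒢f` follows from that for the extension: the formula agrees with `F` where the
  -- integral converges absolutely, and elsewhere the Bochner integral is `0`, which only decreases
  -- the norm.
  by_cases hint : Integrable (fun y => K z (s, y) • f (s, y)) volume
  · rw [hs hint]
  · rw [StochHormander.kernelTransform, integral_undef hint]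
    simp
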